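/- For a lattice $\Lambda\subset\mathbb R^2$ of full rank let $|\Lambda|=\min\{\|x\| : x\in\Lambda\setminus\{0\}\}$ (Euclidean norm) and $S(\Lambda)=\{x\in\Lambda:\|x\|=|\Lambda|\}$. Call $\Lambda$ well-rounded (WR) if $S(\Lambda)$ spans $\mathbb R^2$ over $\mathbb R$, and for a lattice $\Omega$ let $\operatorname{WR}(\Omega)$ be the set of all full-rank WR sublattices of $\Omega$. Put $$\mathcal D=\{\det\Lambda:\Lambda\in\operatorname{WR}(\mathbb Z^2)\},\qquad \mathfrak M=\{|\Lambda|^2:\Lambda\in\operatorname{WR}(\mathbb Z^2)\},$$ and for a positive integer $u$ let $\mathcal N(u)$ be the number of $\Lambda\in\operatorname{WR}(\mathbb Z^2)$ with $\det\Lambda=u$. For a positive integer $t$ let $$\beta(t)=\left|\left\{d\in\mathbb Z_{>0} : d\mid t,\ \tfrac{\sqrt t}{3^{1/4}}\le d\le\sqrt t\right\}\right|,$$ let $\alpha_*(1)=\alpha_*(2)=\frac12$, and for $t>2$ let $\alpha_*(t)$ be the number of pairs of integers $0\le a\le b$ with $a^2+b^2=t$ and $\gcd(a,b)=1$. Let $\gamma(t)=2\beta(t)-1$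 if $t$ is a square, $\gamma(t)=2\beta(t)$ if $t$ is not a square. **Theorem.** Let $A\in O_2(\mathbb R)$. Then the determinant set $\{\det\Lambda:\Lambda\in\operatorname{WR}(A\mathbb Z^2)\}$ equals $\mathcal D$, and the minima set $\{|\Lambda|^2:\Lambda\in\operatorname{WR}(A\mathbb Z^2)\}$ equals $\mathfrak M$. Every element of $\mathcal D$ is a positive integer, and for every positive integer $u$ (in particular for every $u\in\mathcal D$) the number of lattices in $\operatorname{WR}(A\mathbb Z^2)$ with determinant $u$ is finite and equals $\mathcal N(u)$. Here $\mathcal N(1)=\mathcal N(2)=1$, and for $u>2$, with $t=u$ if $u$ is odd and $t=u/2$ if $u$ is even, $$\mathcal N(u)=\gamma(t)+\varepsilon(t)+4\sum_{\substack{n\mid t,\ 1<n<t/2\\ n\text{ not a square}}}\alpha_*\!\left(\tfrac tn\right)\beta(n)+2\sum_{\substack{n\mid t,\ 1\le n<t/2\\ n\text{ a square}}}\alpha_*\!\left(\tfrac tn\right)\bigl(2\beta(n)-1\bigr),$$ where $\varepsilon(t)=\gamma(t/2)$ if $t$ is even and $\varepsilon(t)=0$ if $t$ is odd. -/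

import Mathlib

/-- The standard integer lattice `ℤ²` in the Euclidean plane. -/
def intLattice : Submodule ℤ (EuclideanSpace ℝ (Fin 2)) :=
  Submodule.span ℤ (Set.range (EuclideanSpace.basisFun (Fin 2) ℝ))

/-- The lattice `A ℤ²`, the image of `ℤ²` under `x ↦ A x`. -/
noncomputable def imageLattice (A : Matrix (Fin 2) (Fin 2) ℝ) :
    Submodule ℤ (EuclideanSpace ℝ (Fin 2)) :=
  intLattice.map ((Matrix.toEuclideanLin A).restrictScalars ℤ)

/-- `Λ` is a lattice of full rank in the plane: it is discrete and spans the plane over `ℝ`. -/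
def IsFullRankLattice (Λ : Submodule ℤ (EuclideanSpace ℝ (Fin 2))) : Prop :=
  DiscreteTopology Λ ∧
    Submodule.span ℝ (Λ : Set (EuclideanSpace ℝ (Fin 2))) = ⊤

/-- The minimum `|Λ|`: the least Euclidean norm of a nonzero vector of `Λ`. -/
noncomputable def latticeMin (Λ : Submodule ℤ (EuclideanSpace ℝ (Fin 2))) : ℝ :=
  sInf {r : ℝ | ∃ x ∈ Λ, x ≠ 0 ∧ ‖x‖ = r}

/-- The set `S(Λ)` of minimal vectors of `Λ`. -/
def minimalVectors (Λ : Submodule ℤ (EuclideanSpace ℝ (Fin 2))) :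
    Set (EuclideanSpace ℝ (Fin 2)) :=
  {x | x ∈ Λ ∧ ‖x‖ = latticeMin Λ}

/-- `Λ` is well-rounded: its minimal vectors span the plane. -/
def IsWellRounded (Λ : Submodule ℤ (EuclideanSpace ℝ (Fin 2))) : Prop :=
  Submodule.span ℝ (minimalVectors Λ) = ⊤

/-- `WR(Ω)`: the set of all full-rank well-rounded sublattices of `Ω`. -/
def WR (Ω : Submodule ℤ (EuclideanSpace ℝ (Fin 2))) :
    Set (Submodule ℤ (EuclideanSpace ℝ (Fin 2))) :=
  {Λ | Λ ≤ Ω ∧ IsFullRankLattice Λ ∧ IsWellRounded Λ}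

/-- The determinant set of the lattices in `WR(Ω)`. -/
def detSet (Ω : Submodule ℤ (EuclideanSpace ℝ (Fin 2))) : Set ℝ :=
  {u | ∃ Λ ∈ WR Ω, ZLattice.covolume Λ = u}

/-- The minima set of `WR(Ω)`: the values `|Λ|²` for `Λ ∈ WR(Ω)`. -/
def minimaSet (Ω : Submodule ℤ (EuclideanSpace ℝ (Fin 2))) : Set ℝ :=
  {m | ∃ Λ ∈ WR Ω, latticeMin Λ ^ 2 = m}

/-- The set of the lattices in `WR(Ω)` with determinant `u`. -/
def WRdet (Ω : Submodule ℤ (EuclideanSpace ℝ (Fin 2))) (u : ℝ) :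
    Set (Submodule ℤ (EuclideanSpace ℝ (Fin 2))) :=
  {Λ | Λ ∈ WR Ω ∧ ZLattice.covolume Λ = u}

/-- `𝒩(u)`: the number of lattices in `WR(ℤ²)` with determinant `u`. -/
noncomputable def numWR (u : ℕ) : ℕ :=
  (WRdet intLattice u).ncard

/-- `α_*(t)`: the number of representations of `t` as a sum of two coprime squares, up to order
and signs, with the convention `α_*(1) = α_*(2) = 1/2`. -/
def alphaStar (t : ℕ) : ℚ :=
  if t = 1 ∨ t = 2 then 1 / 2
  else (((Finset.range (t + 1) ×ˢ Finset.range (t + 1)).filter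
    (fun p : ℕ × ℕ => p.1 ^ 2 + p.2 ^ 2 = t ∧ p.1 ≤ p.2 ∧ Nat.gcd p.1 p.2 = 1)).card : ℚ)

/-- `β_ν(t)`: the number of positive divisors `d` of `t` with `√t / ν ≤ d ≤ √t`. -/
noncomputable def betaNu (ν : ℝ) (t : ℕ) : ℕ :=
  (t.divisors.filter (fun d : ℕ => √(t : ℝ) / ν ≤ (d : ℝ) ∧ (d : ℝ) ≤ √(t : ℝ))).card

/-- `β(t) = β_ν(t)` for `ν = 3^{1/4}`. -/
noncomputable def beta (t : ℕ) : ℕ :=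
  betaNu ((3 : ℝ) ^ (1 / 4 : ℝ)) t

/-- `2 β(n) - 1` if `n` is a square, and `2 β(n)` otherwise. -/
noncomputable def gammaTerm (n : ℕ) : ℚ :=
  if IsSquare n then 2 * (beta n : ℚ) - 1 else 2 * (beta n : ℚ)

/-- `t(u)`: `u` if `u` is odd and `u / 2` if `u` is even. -/
def tOf (u : ℕ) : ℕ :=
  if Even u then u / 2 else u

/-- The explicit expression for the number of lattices of determinant `u > 2`,
in terms of `t = t(u)`. -/
noncomputable def countFormula (t : ℕ) : ℚ :=
  gammaTerm t + (if Even t then gammaTerm (t / 2) else 0)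
    + 4 * ∑ n ∈ t.divisors.filter (fun n => 1 < n ∧ 2 * n < t ∧ ¬ IsSquare n),
        alphaStar (t / n) * (beta n : ℚ)
    + 2 * ∑ n ∈ t.divisors.filter (fun n => 1 ≤ n ∧ 2 * n < t ∧ IsSquare n),
        alphaStar (t / n) * (2 * (beta n : ℚ) - 1)

/-! An orthogonal matrix acts as a linear isometry, which carries sublattices to sublattices and
preserves covolume, minimum and minimal vectors. Everything therefore reduces to `intLattice`.

A well-rounded sublattice of the integer lattice is generated by two minimal vectors x, y of equal
length at an angle in [60°, 120°] (`exists_isMinimalPair_of_mem_WR`). The extreme angles would make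
√3 rational, so the minimal vectors are exactly ±x, ±y, and the lattice determines the pair up to
order and signs (`eq_of_pairLattice_eq`).

Pass to the diagonals x + y, x - y of the rhombus. They are orthogonal, span area 2u, and their
lengths have ratio between 1/√3 and √3. As Gaussian integers they are both divisible by 2 if u is
even and by 1 + i if u is odd; the quotients form an orthogonal pair of area t. Such a pair is, up
to order and signs, k(r, s), l(-s, r) with gcd(r, s) = 1, r > 0, s ≥ 0 and k l (r² + s²) = t, and
these parameters are unique (`exists_param_samePair`, `eq_of_samePair`). Conversely all such
parameters occur.

Grouping by n = k l gives 𝒩(u) = ∑ 2 α_*(t/n) γ(n) over n ∣ t. The terms n = t and n = t/2 are γ(t)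
and ε(t), because α_*(1) = α_*(2) = 1/2; the others split according to whether n is a square. -/

open MeasureTheory Module

local notation "𝔼" => EuclideanSpace ℝ (Fin 2)

/-! ### Transport along linear isometries. -/

/-- The image of a `ℤ`-submodule of the plane under a linear isometry. -/
noncomputable def isometryMap (f : 𝔼 ≃ₗᵢ[ℝ] 𝔼) (Λ : Submodule ℤ 𝔼) : Submodule ℤ 𝔼 :=
  Λ.map (f.toLinearEquiv.toLinearMap.restrictScalars ℤ)

theorem mem_isometryMap {f : 𝔼 ≃ₗᵢ[ℝ] 𝔼} {Λ : Submodule ℤ 𝔼} {x : 𝔼} :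
    x ∈ isometryMap f Λ ↔ ∃ y ∈ Λ, f y = x := by
  simp [isometryMap, Submodule.mem_map]

theorem coe_isometryMap (f : 𝔼 ≃ₗᵢ[ℝ] 𝔼) (Λ : Submodule ℤ 𝔼) :
    (isometryMap f Λ : Set 𝔼) = f '' Λ := by
  ext x; simp [mem_isometryMap]

theorem isometryMap_symm (f : 𝔼 ≃ₗᵢ[ℝ] 𝔼) (Λ : Submodule ℤ 𝔼) :
    isometryMap f.symm (isometryMap f Λ) = Λ := by
  ext x
  simp [mem_isometryMap]

theorem isometryMap_mono (f : 𝔼 ≃ₗᵢ[ℝ] 𝔼) {Λ Ω : Submodule ℤ 𝔼} (h : Λ ≤ Ω) :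
    isometryMap f Λ ≤ isometryMap f Ω :=
  Submodule.map_mono h

theorem latticeMin_isometryMap (f : 𝔼 ≃ₗᵢ[ℝ] 𝔼) (Λ : Submodule ℤ 𝔼) :
    latticeMin (isometryMap f Λ) = latticeMin Λ := by
  unfold latticeMin
  congr 1
  ext r
  constructor
  · rintro ⟨x, hx, hx0, rfl⟩
    obtain ⟨y, hy, rfl⟩ := mem_isometryMap.1 hx
    exact ⟨y, hy, fun h => hx0 (by simp [h]), by simp⟩
  · rintro ⟨y, hy, hy0, rfl⟩
    exact ⟨f y, mem_isometryMap.2 ⟨y, hy, rfl⟩, by simpa using hy0, by simp⟩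

theorem minimalVectors_isometryMap (f : 𝔼 ≃ₗᵢ[ℝ] 𝔼) (Λ : Submodule ℤ 𝔼) :
    minimalVectors (isometryMap f Λ) = f '' minimalVectors Λ := by
  ext x
  simp only [minimalVectors, latticeMin_isometryMap, Set.mem_ofPred_eq, Set.mem_image,
    mem_isometryMap]
  constructor
  · rintro ⟨⟨y, hy, rfl⟩, h⟩
    exact ⟨y, ⟨hy, by simpa using h⟩, rfl⟩
  · rintro ⟨y, ⟨hy, h⟩, rfl⟩
    exact ⟨⟨y, hy, rfl⟩, by simpa using h⟩

theorem span_image_isometry_eq_top (f : 𝔼 ≃ₗᵢ[ℝ] 𝔼) {s : Set 𝔼}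
    (h : Submodule.span ℝ s = ⊤) : Submodule.span ℝ (f '' s) = ⊤ := by
  have : f '' s = f.toLinearEquiv.toLinearMap '' s := rfl
  rw [this, Submodule.span_image, h, Submodule.map_top, LinearEquiv.range]

/-- In the form of a `ZLattice.comap` the image inherits discreteness by instance, and its covolume
is given by `ZLattice.covolume_comap`. -/
theorem isometryMap_eq_comap (f : 𝔼 ≃ₗᵢ[ℝ] 𝔼) (Λ : Submodule ℤ 𝔼) :
    isometryMap f Λ =
      ZLattice.comap ℝ Λ f.symm.toContinuousLinearEquiv.toLinearMap := by
  ext x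
  rw [mem_isometryMap, ZLattice.comap, Submodule.mem_comap]
  constructor
  · rintro ⟨y, hy, rfl⟩
    simpa using hy
  · intro h
    exact ⟨f.symm x, by simpa using h, by simp⟩

theorem isFullRankLattice_isometryMap (f : 𝔼 ≃ₗᵢ[ℝ] 𝔼) {Λ : Submodule ℤ 𝔼}
    (h : IsFullRankLattice Λ) : IsFullRankLattice (isometryMap f Λ) := by
  obtain ⟨h1, h2⟩ := h
  refine ⟨?_, ?_⟩
  · rw [isometryMap_eq_comap]
    infer_instance
  · rw [coe_isometryMap]
    exact span_image_isometry_eq_top f h2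

theorem isometryMap_mem_WR (f : 𝔼 ≃ₗᵢ[ℝ] 𝔼) {Λ Ω : Submodule ℤ 𝔼} (h : Λ ∈ WR Ω) :
    isometryMap f Λ ∈ WR (isometryMap f Ω) := by
  obtain ⟨h1, h2, h3⟩ := h
  refine ⟨isometryMap_mono f h1, isFullRankLattice_isometryMap f h2, ?_⟩
  unfold IsWellRounded
  rw [minimalVectors_isometryMap]
  exact span_image_isometry_eq_top f h3

theorem covolume_isometryMap (f : 𝔼 ≃ₗᵢ[ℝ] 𝔼) {Λ : Submodule ℤ 𝔼}
    (h : IsFullRankLattice Λ) :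
    ZLattice.covolume (isometryMap f Λ) = ZLattice.covolume Λ := by
  have := h.1
  have : IsZLattice ℝ Λ := ⟨h.2⟩
  rw [isometryMap_eq_comap]
  exact ZLattice.covolume_comap Λ volume volume (e := f.symm.toContinuousLinearEquiv)
    f.symm.measurePreserving

theorem exists_isometryMap_of_mem_WR (f : 𝔼 ≃ₗᵢ[ℝ] 𝔼) {Λ Ω : Submodule ℤ 𝔼}
    (h : Λ ∈ WR (isometryMap f Ω)) : ∃ Γ ∈ WR Ω, isometryMap f Γ = Λ := by
  refine ⟨isometryMap f.symm Λ, ?_, ?_⟩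
  · simpa only [isometryMap_symm] using isometryMap_mem_WR f.symm h
  · exact isometryMap_symm f.symm Λ

theorem detSet_isometryMap (f : 𝔼 ≃ₗᵢ[ℝ] 𝔼) (Ω : Submodule ℤ 𝔼) :
    detSet (isometryMap f Ω) = detSet Ω := by
  ext u
  constructor
  · rintro ⟨Λ, hΛ, rfl⟩
    obtain ⟨Γ, hΓ, rfl⟩ := exists_isometryMap_of_mem_WR f hΛ
    exact ⟨Γ, hΓ, (covolume_isometryMap f hΓ.2.1).symm⟩
  · rintro ⟨Γ, hΓ, rfl⟩
    exact ⟨_, isometryMap_mem_WR f hΓ, covolume_isometryMap f hΓ.2.1⟩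

theorem minimaSet_isometryMap (f : 𝔼 ≃ₗᵢ[ℝ] 𝔼) (Ω : Submodule ℤ 𝔼) :
    minimaSet (isometryMap f Ω) = minimaSet Ω := by
  ext u
  constructor
  · rintro ⟨Λ, hΛ, rfl⟩
    obtain ⟨Γ, hΓ, rfl⟩ := exists_isometryMap_of_mem_WR f hΛ
    exact ⟨Γ, hΓ, by rw [latticeMin_isometryMap]⟩
  · rintro ⟨Γ, hΓ, rfl⟩
    exact ⟨_, isometryMap_mem_WR f hΓ, by rw [latticeMin_isometryMap]⟩

theorem isometryMap_injective (f : 𝔼 ≃ₗᵢ[ℝ] 𝔼) : Function.Injective (isometryMap f) :=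
  Function.LeftInverse.injective (isometryMap_symm f)

theorem WRdet_isometryMap (f : 𝔼 ≃ₗᵢ[ℝ] 𝔼) (Ω : Submodule ℤ 𝔼) (u : ℝ) :
    WRdet (isometryMap f Ω) u = isometryMap f '' WRdet Ω u := by
  ext Λ
  constructor
  · rintro ⟨hΛ, rfl⟩
    obtain ⟨Γ, hΓ, rfl⟩ := exists_isometryMap_of_mem_WR f hΛ
    exact ⟨Γ, ⟨hΓ, (covolume_isometryMap f hΓ.2.1).symm⟩, rfl⟩
  · rintro ⟨Γ, ⟨hΓ, rfl⟩, rfl⟩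
    exact ⟨isometryMap_mem_WR f hΓ, covolume_isometryMap f hΓ.2.1⟩

theorem norm_toEuclideanLin_of_mem_orthogonalGroup {A : Matrix (Fin 2) (Fin 2) ℝ}
    (hA : A ∈ Matrix.orthogonalGroup (Fin 2) ℝ) (x : 𝔼) :
    ‖Matrix.toEuclideanLin A x‖ = ‖x‖ := by
  rw [Matrix.mem_orthogonalGroup_iff'] at hA
  have h00 := congrFun (congrFun hA 0) 0
  have h01 := congrFun (congrFun hA 0) 1
  have h11 := congrFun (congrFun hA 1) 1
  simp [Matrix.mul_apply, Fin.sum_univ_two] at h00 h01 h11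
  rw [EuclideanSpace.norm_eq, EuclideanSpace.norm_eq]
  congr 1
  simp [Fin.sum_univ_two, Matrix.toLpLin_apply]
  linear_combination x 0 ^ 2 * h00 + 2 * x 0 * x 1 * h01 + x 1 ^ 2 * h11

theorem exists_imageLattice_eq_isometryMap {A : Matrix (Fin 2) (Fin 2) ℝ}
    (hA : A ∈ Matrix.orthogonalGroup (Fin 2) ℝ) :
    ∃ f : 𝔼 ≃ₗᵢ[ℝ] 𝔼, imageLattice A = isometryMap f intLattice := by
  let g : 𝔼 →ₗᵢ[ℝ] 𝔼 :=
    ⟨Matrix.toEuclideanLin A, norm_toEuclideanLin_of_mem_orthogonalGroup hA⟩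
  refine ⟨g.toLinearIsometryEquiv rfl, ?_⟩
  rfl

/-! ### Integer vectors and the lattices spanned by two of them. -/

/-- The integer vector `(a, b)` as a point of the plane. -/
noncomputable def intVec (a b : ℤ) : 𝔼 := !₂[(a : ℝ), (b : ℝ)]

@[simp] theorem intVec_zero (a b : ℤ) : intVec a b 0 = a := rfl

@[simp] theorem intVec_one (a b : ℤ) : intVec a b 1 = b := rfl

theorem intVec_inj {a b c d : ℤ} : intVec a b = intVec c d ↔ a = c ∧ b = d := by
  constructor
  · intro h
    have h0 := congrArg (fun z : 𝔼 => z 0) h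
    have h1 := congrArg (fun z : 𝔼 => z 1) h
    simp only [intVec_zero, intVec_one] at h0 h1
    exact ⟨by exact_mod_cast h0, by exact_mod_cast h1⟩
  · rintro ⟨rfl, rfl⟩; rfl

theorem intVec_eq_zero {a b : ℤ} : intVec a b = 0 ↔ a = 0 ∧ b = 0 := by
  have : (0 : 𝔼) = intVec 0 0 := by ext i; fin_cases i <;> simp [intVec]
  rw [this, intVec_inj]

theorem norm_intVec_sq (a b : ℤ) : ‖intVec a b‖ ^ 2 = ((a ^ 2 + b ^ 2 : ℤ) : ℝ) := by
  rw [EuclideanSpace.norm_sq_eq]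
  simp [Fin.sum_univ_two]

theorem zsmul_intVec_add (p q a b c d : ℤ) :
    p • intVec a b + q • intVec c d = intVec (p * a + q * c) (p * b + q * d) := by
  ext i; fin_cases i <;> simp

theorem norm_intVec_le_iff {a b c d : ℤ} :
    ‖intVec a b‖ ≤ ‖intVec c d‖ ↔ a ^ 2 + b ^ 2 ≤ c ^ 2 + d ^ 2 := by
  rw [← sq_le_sq₀ (norm_nonneg _) (norm_nonneg _), norm_intVec_sq, norm_intVec_sq, Int.cast_le]

theorem norm_intVec_eq_iff {a b c d : ℤ} :
    ‖intVec a b‖ = ‖intVec c d‖ ↔ a ^ 2 + b ^ 2 = c ^ 2 + d ^ 2 := by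
  rw [le_antisymm_iff, norm_intVec_le_iff, norm_intVec_le_iff, ← le_antisymm_iff]

theorem mem_intLattice {z : 𝔼} : z ∈ intLattice ↔ ∃ a b : ℤ, z = intVec a b := by
  have h : Set.range (EuclideanSpace.basisFun (Fin 2) ℝ) = {intVec 1 0, intVec 0 1} := by
    ext z
    simp only [Set.mem_range, Fin.exists_fin_two, Set.mem_insert_iff, Set.mem_singleton_iff]
    have h0 : (EuclideanSpace.basisFun (Fin 2) ℝ) 0 = intVec 1 0 := by
      ext i; fin_cases i <;> simp
    have h1 : (EuclideanSpace.basisFun (Fin 2) ℝ) 1 = intVec 0 1 := by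
      ext i; fin_cases i <;> simp
    rw [h0, h1, eq_comm, @eq_comm _ (intVec 0 1)]
  rw [intLattice, h, Submodule.mem_span_pair]
  simp [zsmul_intVec_add, eq_comm]

/-- The `ℤ`-span of the integer vectors `(a, b)` and `(c, d)`. -/
noncomputable def pairLattice (a b c d : ℤ) : Submodule ℤ 𝔼 :=
  Submodule.span ℤ {intVec a b, intVec c d}

theorem mem_pairLattice {a b c d : ℤ} {z : 𝔼} :
    z ∈ pairLattice a b c d ↔ ∃ p q : ℤ, z = intVec (p * a + q * c) (p * b + q * d) := by
  simp [pairLattice, Submodule.mem_span_pair, zsmul_intVec_add, eq_comm]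

theorem pairLattice_le_intLattice (a b c d : ℤ) : pairLattice a b c d ≤ intLattice := by
  intro z hz
  obtain ⟨p, q, rfl⟩ := mem_pairLattice.1 hz
  exact mem_intLattice.2 ⟨_, _, rfl⟩

theorem linearIndependent_intVec {a b c d : ℤ} (h : a * d - b * c ≠ 0) :
    LinearIndependent ℝ ![intVec a b, intVec c d] := by
  rw [LinearIndependent.pair_iff]
  intro s t hst
  have h0 := congrArg (fun z : 𝔼 => z 0) hst
  have h1 := congrArg (fun z : 𝔼 => z 1) hst
  simp at h0 h1
  have hD : ((a : ℝ) * d - b * c) ≠ 0 := by exact_mod_cast h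
  constructor
  · apply (mul_eq_zero.1 (_ : s * ((a : ℝ) * d - b * c) = 0)).resolve_right hD
    linear_combination d * h0 - c * h1
  · apply (mul_eq_zero.1 (_ : t * ((a : ℝ) * d - b * c) = 0)).resolve_right hD
    linear_combination a * h1 - b * h0

/-- The basis of the plane given by two independent integer vectors. -/
noncomputable def intBasis {a b c d : ℤ} (h : a * d - b * c ≠ 0) : Basis (Fin 2) ℝ 𝔼 :=
  basisOfLinearIndependentOfCardEqFinrank (linearIndependent_intVec h) (by simp)

theorem coe_intBasis {a b c d : ℤ} (h : a * d - b * c ≠ 0) :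
    ⇑(intBasis h) = ![intVec a b, intVec c d] := by
  simp [intBasis]

theorem pairLattice_eq_span_intBasis {a b c d : ℤ} (h : a * d - b * c ≠ 0) :
    pairLattice a b c d = Submodule.span ℤ (Set.range (intBasis h)) := by
  rw [coe_intBasis, pairLattice]
  congr 1
  simp [Matrix.range_cons]
  exact Set.pair_comm _ _

theorem span_real_intVec {a b c d : ℤ} (h : a * d - b * c ≠ 0) :
    Submodule.span ℝ {intVec a b, intVec c d} = ⊤ := by
  rw [← (intBasis h).span_eq, coe_intBasis]
  congr 1
  simp [Matrix.range_cons]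
  exact Set.pair_comm _ _

theorem isFullRankLattice_pairLattice {a b c d : ℤ} (h : a * d - b * c ≠ 0) :
    IsFullRankLattice (pairLattice a b c d) := by
  constructor
  · rw [pairLattice_eq_span_intBasis h]
    infer_instance
  · rw [eq_top_iff, ← span_real_intVec h]
    exact Submodule.span_mono Submodule.subset_span

theorem volume_real_fundamentalDomain_basisFun :
    volume.real (ZSpan.fundamentalDomain (EuclideanSpace.basisFun (Fin 2) ℝ).toBasis) = 1 := by
  rw [measureReal_congr (ZSpan.fundamentalDomain_ae_parallelepiped _ volume), measureReal_def]
  simp [OrthonormalBasis.volume_parallelepiped]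

theorem covolume_pairLattice {a b c d : ℤ} (h : a * d - b * c ≠ 0) :
    ZLattice.covolume (pairLattice a b c d) = ((|a * d - b * c| : ℤ) : ℝ) := by
  rw [pairLattice_eq_span_intBasis h,
    ZLattice.covolume_eq_measure_fundamentalDomain _ volume
      (ZSpan.isAddFundamentalDomain (intBasis h) volume),
    ZSpan.measureReal_fundamentalDomain _ volume (EuclideanSpace.basisFun (Fin 2) ℝ).toBasis,
    volume_real_fundamentalDomain_basisFun, coe_intBasis, mul_one, Basis.det_apply,
    Matrix.det_fin_two]
  simp [Basis.toMatrix_apply, mul_comm]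

/-! ### Minimal pairs and the minimal vectors of their lattices. -/

theorem sq_ne_three_mul_sq {x y : ℤ} (hx : x ≠ 0) : x ^ 2 ≠ 3 * y ^ 2 := by
  intro h
  have hy : (y : ℝ) ≠ 0 := by
    rintro h0
    have : y = 0 := by exact_mod_cast h0
    subst this
    simp at h
    exact hx h
  have h3 : Irrational √3 := by exact_mod_cast Nat.prime_three.irrational_sqrt
  apply h3
  refine ⟨|(x : ℚ) / y|, ?_⟩
  have h' : (x : ℝ) ^ 2 = 3 * y ^ 2 := by exact_mod_cast h
  rw [eq_comm, Real.sqrt_eq_iff_mul_self_eq (by norm_num) (by push_cast; positivity)]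
  push_cast
  rw [abs_mul_abs_self]
  field_simp
  linarith

/-- The integer vectors `(a, b)`, `(c, d)` are independent, of equal length and at an angle
between `60` and `120` degrees. -/
structure IsMinimalPair (a b c d : ℤ) : Prop where
  norm_eq : a ^ 2 + b ^ 2 = c ^ 2 + d ^ 2
  two_mul_inner_le : 2 * |a * c + b * d| ≤ a ^ 2 + b ^ 2
  det_ne : a * d - b * c ≠ 0

namespace IsMinimalPair

variable {a b c d : ℤ}

/-- Equality is the hexagonal case. By Lagrange's identity det² + inner² = (a² + b²)(c² + d²), it
would give det² = 3 inner². -/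
theorem two_mul_inner_lt (h : IsMinimalPair a b c d) :
    2 * |a * c + b * d| < a ^ 2 + b ^ 2 := by
  refine lt_of_le_of_ne h.two_mul_inner_le fun he => ?_
  apply sq_ne_three_mul_sq (y := a * c + b * d) h.det_ne
  have h1 : (2 * |a * c + b * d|) ^ 2 = (a ^ 2 + b ^ 2) ^ 2 := by rw [he]
  rw [mul_pow, sq_abs] at h1
  linear_combination h1 * (-1) + (a ^ 2 + b ^ 2) * h.norm_eq * (-1)

theorem norm_pos (h : IsMinimalPair a b c d) : 0 < a ^ 2 + b ^ 2 :=
  lt_of_le_of_lt (by positivity) h.two_mul_inner_lt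

theorem norm_comb (h : IsMinimalPair a b c d) (p q : ℤ) :
    (p * a + q * c) ^ 2 + (p * b + q * d) ^ 2 =
      (p ^ 2 + q ^ 2) * (a ^ 2 + b ^ 2) + 2 * (p * q) * (a * c + b * d) := by
  linear_combination -q ^ 2 * h.norm_eq

theorem neg_le_two_mul (h : IsMinimalPair a b c d) (r : ℤ) :
    -(|r| * (a ^ 2 + b ^ 2)) ≤ 2 * r * (a * c + b * d) := by
  have h1 : |2 * r * (a * c + b * d)| ≤ |r| * (a ^ 2 + b ^ 2) := by
    rw [abs_mul, abs_mul, abs_two]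
    nlinarith [mul_le_mul_of_nonneg_left h.two_mul_inner_le (abs_nonneg r)]
  linarith [neg_abs_le (2 * r * (a * c + b * d))]

theorem neg_lt_two_mul (h : IsMinimalPair a b c d) {r : ℤ} (hr : r ≠ 0) :
    -(|r| * (a ^ 2 + b ^ 2)) < 2 * r * (a * c + b * d) := by
  have h1 : |2 * r * (a * c + b * d)| < |r| * (a ^ 2 + b ^ 2) := by
    rw [abs_mul, abs_mul, abs_two]
    nlinarith [mul_lt_mul_of_pos_left h.two_mul_inner_lt (abs_pos.2 hr)]
  linarith [neg_abs_le (2 * r * (a * c + b * d))]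

/-- The form is positive definite and takes integer values. Times the minimal norm, it bounds from
below the norm of the combination px + qy. -/
theorem one_le_form {p q : ℤ} (h : p ≠ 0 ∨ q ≠ 0) : 1 ≤ p ^ 2 + q ^ 2 - |p * q| := by
  have : 0 < p ^ 2 + q ^ 2 - |p * q| := by
    rcases abs_cases (p * q) with ⟨h1, -⟩ | ⟨h1, -⟩ <;> rw [h1] <;> rcases h with h | h <;>
      have := sq_pos_of_ne_zero h <;>
      nlinarith [sq_nonneg (p + 2 * q), sq_nonneg (p - 2 * q), sq_nonneg (2 * p + q),
        sq_nonneg (2 * p - q)]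
  omega

theorem norm_le_comb (h : IsMinimalPair a b c d) {p q : ℤ} (hpq : p ≠ 0 ∨ q ≠ 0) :
    a ^ 2 + b ^ 2 ≤ (p * a + q * c) ^ 2 + (p * b + q * d) ^ 2 := by
  rw [h.norm_comb]
  nlinarith [h.neg_le_two_mul (p * q), mul_le_mul_of_nonneg_right (one_le_form hpq) h.norm_pos.le]

theorem eq_zero_or_eq_zero_of_norm_comb (h : IsMinimalPair a b c d) {p q : ℤ}
    (he : (p * a + q * c) ^ 2 + (p * b + q * d) ^ 2 = a ^ 2 + b ^ 2) :
    (p = 0 ∧ (q = 1 ∨ q = -1)) ∨ (q = 0 ∧ (p = 1 ∨ p = -1)) := by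
  -- If pq ≠ 0, the strict inner product bound makes the combination strictly longer than x.
  have hpq : p * q = 0 := by
    by_contra h0
    have hp : p ≠ 0 ∨ q ≠ 0 := Or.inl (left_ne_zero_of_mul h0)
    rw [h.norm_comb] at he
    nlinarith [h.neg_lt_two_mul h0, mul_le_mul_of_nonneg_right (one_le_form hp) h.norm_pos.le]
  rw [h.norm_comb, hpq] at he
  have h1 : (p ^ 2 + q ^ 2 - 1) * (a ^ 2 + b ^ 2) = 0 := by linear_combination he
  have h2 : p ^ 2 + q ^ 2 = 1 := by
    have := (mul_eq_zero.1 h1).resolve_right h.norm_pos.ne'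
    linarith
  rcases mul_eq_zero.1 hpq with rfl | rfl
  · left
    exact ⟨rfl, mul_self_eq_one_iff.1 (by linarith)⟩
  · right
    exact ⟨rfl, mul_self_eq_one_iff.1 (by linarith)⟩

end IsMinimalPair

namespace IsMinimalPair

variable {a b c d : ℤ}

theorem norm_le_of_mem (h : IsMinimalPair a b c d) {z : 𝔼} (hz : z ∈ pairLattice a b c d)
    (hz0 : z ≠ 0) : ‖intVec a b‖ ≤ ‖z‖ := by
  obtain ⟨p, q, rfl⟩ := mem_pairLattice.1 hz
  rw [norm_intVec_le_iff]
  apply h.norm_le_comb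
  by_contra! h0
  apply hz0
  simp [h0, intVec_eq_zero]

theorem left_mem : intVec a b ∈ pairLattice a b c d :=
  Submodule.subset_span (by simp)

theorem left_ne_zero (h : IsMinimalPair a b c d) : intVec a b ≠ 0 := by
  rw [Ne, intVec_eq_zero]
  rintro ⟨rfl, rfl⟩
  simpa using h.norm_pos

theorem latticeMin_eq (h : IsMinimalPair a b c d) :
    latticeMin (pairLattice a b c d) = ‖intVec a b‖ := by
  refine IsLeast.csInf_eq ⟨⟨_, left_mem, h.left_ne_zero, rfl⟩, ?_⟩
  rintro r ⟨z, hz, hz0, rfl⟩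
  exact h.norm_le_of_mem hz hz0

theorem mem_minimalVectors_iff (h : IsMinimalPair a b c d) {e f : ℤ} :
    intVec e f ∈ minimalVectors (pairLattice a b c d) ↔
      (e = a ∧ f = b) ∨ (e = -a ∧ f = -b) ∨ (e = c ∧ f = d) ∨ (e = -c ∧ f = -d) := by
  rw [minimalVectors, Set.mem_ofPred_eq, h.latticeMin_eq, norm_intVec_eq_iff]
  constructor
  · rintro ⟨hz, hn⟩
    obtain ⟨p, q, hpq⟩ := mem_pairLattice.1 hz
    rw [intVec_inj] at hpq
    obtain ⟨rfl, rfl⟩ := hpq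
    rcases h.eq_zero_or_eq_zero_of_norm_comb hn with ⟨rfl, rfl | rfl⟩ | ⟨rfl, rfl | rfl⟩ <;> simp
  · have := h.norm_eq
    rintro (⟨rfl, rfl⟩ | ⟨rfl, rfl⟩ | ⟨rfl, rfl⟩ | ⟨rfl, rfl⟩)
    · exact ⟨mem_pairLattice.2 ⟨1, 0, by simp⟩, by linarith⟩
    · exact ⟨mem_pairLattice.2 ⟨-1, 0, by simp⟩, by linarith⟩
    · exact ⟨mem_pairLattice.2 ⟨0, 1, by simp⟩, by linarith⟩
    · exact ⟨mem_pairLattice.2 ⟨0, -1, by simp⟩, by linarith⟩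

theorem mem_WR (h : IsMinimalPair a b c d) : pairLattice a b c d ∈ WR intLattice := by
  refine ⟨pairLattice_le_intLattice _ _ _ _, isFullRankLattice_pairLattice h.det_ne, ?_⟩
  unfold IsWellRounded
  rw [eq_top_iff, ← span_real_intVec h.det_ne]
  refine Submodule.span_mono ?_
  rintro z (rfl | rfl)
  · exact h.mem_minimalVectors_iff.2 (by simp)
  · exact h.mem_minimalVectors_iff.2 (by simp)

/-- A lattice determines its minimal pair up to order and signs. -/
theorem eq_of_pairLattice_eq {a' b' c' d' : ℤ} (h : IsMinimalPair a b c d)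
    (h' : IsMinimalPair a' b' c' d') (he : pairLattice a b c d = pairLattice a' b' c' d') :
    ∃ σ τ : ℤ, (σ = 1 ∨ σ = -1) ∧ (τ = 1 ∨ τ = -1) ∧
      ((a = σ * a' ∧ b = σ * b' ∧ c = τ * c' ∧ d = τ * d') ∨
        (a = σ * c' ∧ b = σ * d' ∧ c = τ * a' ∧ d = τ * b')) := by
  have hx : intVec a b ∈ minimalVectors (pairLattice a b c d) :=
    h.mem_minimalVectors_iff.2 (by simp)
  have hy : intVec c d ∈ minimalVectors (pairLattice a b c d) :=
    h.mem_minimalVectors_iff.2 (by simp)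
  rw [he, h'.mem_minimalVectors_iff] at hx hy
  have hD := h.det_ne
  rcases hx with ⟨rfl, rfl⟩ | ⟨rfl, rfl⟩ | ⟨rfl, rfl⟩ | ⟨rfl, rfl⟩ <;>
    rcases hy with ⟨rfl, rfl⟩ | ⟨rfl, rfl⟩ | ⟨rfl, rfl⟩ | ⟨rfl, rfl⟩
  · exact absurd (by ring) hD
  · exact absurd (by ring) hD
  · exact ⟨1, 1, by simp⟩
  · exact ⟨1, -1, by simp⟩
  · exact absurd (by ring) hD
  · exact absurd (by ring) hD
  · exact ⟨-1, 1, by simp⟩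
  · exact ⟨-1, -1, by simp⟩
  · exact ⟨1, 1, by simp⟩
  · exact ⟨1, -1, by simp⟩
  · exact absurd (by ring) hD
  · exact absurd (by ring) hD
  · exact ⟨-1, 1, by simp⟩
  · exact ⟨-1, -1, by simp⟩
  · exact absurd (by ring) hD
  · exact absurd (by ring) hD

end IsMinimalPair

/-! ### Every well-rounded integer lattice comes from a minimal pair. -/

theorem exists_int_two_mul_abs_sub_mul_le (n D : ℤ) (hD : D ≠ 0) :
    ∃ k : ℤ, 2 * |n - k * D| ≤ |D| := by
  obtain ⟨k, hk⟩ : ∃ k : ℤ, |(n : ℚ) / D - k| ≤ 1 / 2 := ⟨_, abs_sub_round _⟩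
  refine ⟨k, ?_⟩
  have hD' : (D : ℚ) ≠ 0 := by exact_mod_cast hD
  have h1 : |(n : ℚ) - k * D| = |(n : ℚ) / D - k| * |(D : ℚ)| := by
    rw [← abs_mul]; congr 1; field_simp
  have h2 : 2 * |(n : ℚ) - k * D| ≤ |(D : ℚ)| := by
    rw [h1]; nlinarith [abs_nonneg (D : ℚ)]
  exact_mod_cast h2

/-- Independent vectors of minimal length of a planar lattice generate it. -/
theorem eq_pairLattice_of_norm_le {Λ : Submodule ℤ 𝔼} (hΛ : Λ ≤ intLattice) {a b c d : ℤ}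
    (h : IsMinimalPair a b c d) (hx : intVec a b ∈ Λ) (hy : intVec c d ∈ Λ)
    (hmin : ∀ e f : ℤ, intVec e f ∈ Λ → intVec e f ≠ 0 → a ^ 2 + b ^ 2 ≤ e ^ 2 + f ^ 2) :
    Λ = pairLattice a b c d := by
  apply le_antisymm
  · intro z hz
    obtain ⟨e, f, rfl⟩ := mem_intLattice.1 (hΛ hz)
    -- By Cramer's rule the coordinates of z in the basis x, y are (ed - fc)/D and (af - be)/D; p
    -- and q are nearest integers to them.
    obtain ⟨p, hp⟩ := exists_int_two_mul_abs_sub_mul_le (e * d - f * c) _ h.det_ne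
    obtain ⟨q, hq⟩ := exists_int_two_mul_abs_sub_mul_le (a * f - b * e) _ h.det_ne
    have hmem : intVec (e - (p * a + q * c)) (f - (p * b + q * d)) ∈ Λ := by
      have h1 : intVec (e - (p * a + q * c)) (f - (p * b + q * d)) =
          intVec e f - (p • intVec a b + q • intVec c d) := by
        rw [zsmul_intVec_add]
        ext i; fin_cases i <;> simp
      rw [h1]
      exact Λ.sub_mem hz (Λ.add_mem (Λ.smul_mem p hx) (Λ.smul_mem q hy))
    suffices h0 : intVec (e - (p * a + q * c)) (f - (p * b + q * d)) = 0 by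
      rw [intVec_eq_zero] at h0
      exact mem_pairLattice.2 ⟨p, q, by rw [intVec_inj]; constructor <;> linarith [h0.1, h0.2]⟩
    by_contra h0
    have hle := hmin _ _ hmem h0
    set P := e * d - f * c - p * (a * d - b * c) with hP
    set Q := a * f - b * e - q * (a * d - b * c) with hQ
    set D := a * d - b * c with hD
    -- The remainder has coordinates P/D, Q/D of absolute value at most 1/2, so its squared norm is
    -- at most 1/4 + 1/4 + 1/4 = 3/4 of the minimal one, a contradiction.
    have hcomb : D ^ 2 * ((e - (p * a + q * c)) ^ 2 + (f - (p * b + q * d)) ^ 2) =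
        (P * a + Q * c) ^ 2 + (P * b + Q * d) ^ 2 := by
      rw [hP, hQ, hD]; ring
    rw [h.norm_comb] at hcomb
    have hDpos : 0 < D ^ 2 := by have := h.det_ne; positivity
    have hP2 : 4 * P ^ 2 ≤ D ^ 2 := by
      have := pow_le_pow_left₀ (by positivity) hp 2
      rw [mul_pow, sq_abs, sq_abs] at this; linarith
    have hQ2 : 4 * Q ^ 2 ≤ D ^ 2 := by
      have := pow_le_pow_left₀ (by positivity) hq 2
      rw [mul_pow, sq_abs, sq_abs] at this; linarith
    have hPQ : 4 * |P * Q| ≤ D ^ 2 := by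
      have h3 : (2 * |P|) * (2 * |Q|) ≤ |D| * |D| := mul_le_mul hp hq (by positivity) (abs_nonneg _)
      rw [abs_mul_abs_self] at h3
      rw [abs_mul]; linarith
    have hub : 2 * (P * Q) * (a * c + b * d) ≤ |P * Q| * (a ^ 2 + b ^ 2) := by
      have h4 := h.neg_le_two_mul (-(P * Q))
      rw [abs_neg] at h4
      linarith
    have hm := h.norm_pos
    nlinarith [mul_le_mul_of_nonneg_left hle hDpos.le, mul_le_mul_of_nonneg_right hP2 hm.le,
      mul_le_mul_of_nonneg_right hQ2 hm.le, mul_le_mul_of_nonneg_right hPQ hm.le,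
      mul_pos hDpos hm]
  · rw [pairLattice, Submodule.span_le]
    rintro z (rfl | rfl)
    · exact hx
    · exact hy

theorem latticeMin_le_norm {Λ : Submodule ℤ 𝔼} {z : 𝔼} (hz : z ∈ Λ) (hz0 : z ≠ 0) :
    latticeMin Λ ≤ ‖z‖ :=
  csInf_le ⟨0, by rintro r ⟨x, -, -, rfl⟩; exact norm_nonneg x⟩ ⟨z, hz, hz0, rfl⟩

theorem exists_ne_zero_mem_of_span_eq_top {s : Set 𝔼} (hs : Submodule.span ℝ s = ⊤)
    (φ : 𝔼 →ₗ[ℝ] ℝ) (hφ : φ ≠ 0) : ∃ z ∈ s, φ z ≠ 0 := by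
  by_contra! h
  exact hφ (LinearMap.ext_on hs fun z hz => by simpa using h z hz)

theorem exists_isMinimalPair_of_mem_WR {Λ : Submodule ℤ 𝔼} (hΛ : Λ ∈ WR intLattice) :
    ∃ a b c d : ℤ, IsMinimalPair a b c d ∧ Λ = pairLattice a b c d := by
  obtain ⟨hle, -, hwr⟩ := hΛ
  let π : Fin 2 → (𝔼 →ₗ[ℝ] ℝ) := fun i => (EuclideanSpace.proj i : 𝔼 →L[ℝ] ℝ).toLinearMap
  have hπ : ∀ i z, π i z = z i := fun _ _ => rfl
  obtain ⟨x, hx, hx0⟩ := exists_ne_zero_mem_of_span_eq_top hwr (π 0) fun h0 => by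
    have := LinearMap.congr_fun h0 (intVec 1 0)
    simp [hπ] at this
  obtain ⟨a, b, rfl⟩ := mem_intLattice.1 (hle hx.1)
  -- This functional is det(x, ·), nonzero since a ≠ 0; a minimal vector outside its kernel is
  -- independent of x.
  obtain ⟨y, hy, hy0⟩ := exists_ne_zero_mem_of_span_eq_top hwr ((a : ℝ) • π 1 - (b : ℝ) • π 0)
    fun h0 => by
      have := LinearMap.congr_fun h0 (intVec 0 1)
      simp [hπ] at this
      simp [hπ, this] at hx0
  obtain ⟨c, d, rfl⟩ := mem_intLattice.1 (hle hy.1)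
  have hdet : a * d - b * c ≠ 0 := by
    simp [hπ] at hy0
    exact_mod_cast hy0
  have hmin : ∀ e f : ℤ, intVec e f ∈ Λ → intVec e f ≠ 0 → a ^ 2 + b ^ 2 ≤ e ^ 2 + f ^ 2 := by
    intro e f hef h0
    rw [← norm_intVec_le_iff, hx.2]
    exact latticeMin_le_norm hef h0
  have hnorm : a ^ 2 + b ^ 2 = c ^ 2 + d ^ 2 := by
    rw [← norm_intVec_eq_iff, hx.2, hy.2]
  -- That x + y and x - y are no shorter than x is what bounds the inner product.
  have hsum := hmin (1 * a + 1 * c) (1 * b + 1 * d)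
    (by rw [← zsmul_intVec_add]; exact Λ.add_mem (Λ.smul_mem _ hx.1) (Λ.smul_mem _ hy.1)) (by
      rw [Ne, intVec_eq_zero]
      rintro ⟨h1, h2⟩
      exact hdet (by linear_combination a * h2 - b * h1))
  have hdiff := hmin (1 * a + (-1) * c) (1 * b + (-1) * d)
    (by rw [← zsmul_intVec_add]; exact Λ.add_mem (Λ.smul_mem _ hx.1) (Λ.smul_mem _ hy.1)) (by
      rw [Ne, intVec_eq_zero]
      rintro ⟨h1, h2⟩
      exact hdet (by linear_combination -a * h2 + b * h1))
  have hpair : IsMinimalPair a b c d := by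
    refine ⟨hnorm, ?_, hdet⟩
    rcases abs_cases (a * c + b * d) with ⟨h1, -⟩ | ⟨h1, -⟩ <;> rw [h1] <;> nlinarith
  exact ⟨a, b, c, d, hpair, eq_pairLattice_of_norm_le hle hpair hx.1 hy.1 hmin⟩

theorem WRdet_intLattice (u : ℝ) :
    WRdet intLattice u = {Λ | ∃ a b c d : ℤ, IsMinimalPair a b c d ∧
      ((|a * d - b * c| : ℤ) : ℝ) = u ∧ Λ = pairLattice a b c d} := by
  ext Λ
  constructor
  · rintro ⟨hΛ, hu⟩
    obtain ⟨a, b, c, d, h, rfl⟩ := exists_isMinimalPair_of_mem_WR hΛ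
    exact ⟨a, b, c, d, h, by rw [← hu, covolume_pairLattice h.det_ne], rfl⟩
  · rintro ⟨a, b, c, d, h, hu, rfl⟩
    exact ⟨h.mem_WR, by rw [← hu, covolume_pairLattice h.det_ne]⟩

theorem exists_nat_of_mem_detSet {u : ℝ} (hu : u ∈ detSet intLattice) :
    ∃ m : ℕ, 0 < m ∧ u = m := by
  obtain ⟨Λ, hΛ, rfl⟩ := hu
  obtain ⟨a, b, c, d, h, rfl⟩ := exists_isMinimalPair_of_mem_WR hΛ
  refine ⟨(a * d - b * c).natAbs, Int.natAbs_pos.2 h.det_ne, ?_⟩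
  rw [covolume_pairLattice h.det_ne, Nat.cast_natAbs]

/-! ### Diagonals of the rhombus and balanced orthogonal pairs. -/

/-- The integer vectors `(p₁, p₂)` and `(q₁, q₂)` are orthogonal, span a rectangle of area `t`,
and the ratio of their lengths lies between `1 / √3` and `√3`. -/
structure IsBalancedOrth (t p₁ p₂ q₁ q₂ : ℤ) : Prop where
  inner_eq : p₁ * q₁ + p₂ * q₂ = 0
  abs_det : |p₁ * q₂ - p₂ * q₁| = t
  left_le : p₁ ^ 2 + p₂ ^ 2 ≤ 3 * (q₁ ^ 2 + q₂ ^ 2)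
  right_le : q₁ ^ 2 + q₂ ^ 2 ≤ 3 * (p₁ ^ 2 + p₂ ^ 2)

/-- The inner product of x + y and x - y is |x|² - |y|². When it vanishes, |x ± y|² = 2|x|² ± 2⟨x,
y⟩, so the two ratio bounds say exactly 2|⟨x, y⟩| ≤ |x|². -/
theorem isMinimalPair_and_iff {u a b c d : ℤ} (hu : 0 < u) :
    IsMinimalPair a b c d ∧ |a * d - b * c| = u ↔
      IsBalancedOrth (2 * u) (a + c) (b + d) (a - c) (b - d) := by
  have hdet : (a + c) * (b - d) - (b + d) * (a - c) = -(2 * (a * d - b * c)) := by ring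
  constructor
  · rintro ⟨h, hD⟩
    have h1 := le_abs_self (a * c + b * d)
    have h2 := neg_abs_le (a * c + b * d)
    have h3 := h.two_mul_inner_le
    have h4 := h.norm_eq
    refine ⟨by linarith, ?_, by linarith, by linarith⟩
    rw [hdet, abs_neg, abs_mul, hD, abs_two]
  · rintro ⟨h1, h2, h3, h4⟩
    rw [hdet, abs_neg, abs_mul, abs_two] at h2
    have hD : |a * d - b * c| = u := by linarith
    refine ⟨⟨by linarith, ?_, ?_⟩, hD⟩
    · rcases abs_cases (a * c + b * d) with ⟨h, -⟩ | ⟨h, -⟩ <;> rw [h] <;> linarith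
    · rw [← abs_pos, hD]; exact hu

theorem isBalancedOrth_two_mul_iff {t p₁ p₂ q₁ q₂ : ℤ} :
    IsBalancedOrth (2 * (2 * t)) (2 * p₁) (2 * p₂) (2 * q₁) (2 * q₂) ↔
      IsBalancedOrth t p₁ p₂ q₁ q₂ := by
  have hdet : 2 * p₁ * (2 * q₂) - 2 * p₂ * (2 * q₁) = 2 * (2 * (p₁ * q₂ - p₂ * q₁)) := by ring
  constructor <;> rintro ⟨h1, h2, h3, h4⟩ <;> refine ⟨by linarith, ?_, by linarith, by linarith⟩
  · rw [hdet, abs_mul, abs_mul, abs_two] at h2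
    linarith
  · rw [hdet, abs_mul, abs_mul, abs_two, h2]

/-- Multiplication by 1 + i rotates by 45° and doubles areas. -/
theorem isBalancedOrth_rotate_iff {t p₁ p₂ q₁ q₂ : ℤ} :
    IsBalancedOrth (2 * t) (p₁ - p₂) (p₁ + p₂) (q₁ - q₂) (q₁ + q₂) ↔
      IsBalancedOrth t p₁ p₂ q₁ q₂ := by
  have hdet : (p₁ - p₂) * (q₁ + q₂) - (p₁ + p₂) * (q₁ - q₂) = 2 * (p₁ * q₂ - p₂ * q₁) := by ring
  constructor <;> rintro ⟨h1, h2, h3, h4⟩ <;> refine ⟨by linarith, ?_, by linarith, by linarith⟩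
  · rw [hdet, abs_mul, abs_two] at h2
    linarith
  · rw [hdet, abs_mul, abs_two, h2]

/-- `(p, q)` is, up to signs and order, the pair `(p', q')`. -/
def SamePair (p₁ p₂ q₁ q₂ p₁' p₂' q₁' q₂' : ℤ) : Prop :=
  ∃ σ τ : ℤ, (σ = 1 ∨ σ = -1) ∧ (τ = 1 ∨ τ = -1) ∧
    ((p₁ = σ * p₁' ∧ p₂ = σ * p₂' ∧ q₁ = τ * q₁' ∧ q₂ = τ * q₂') ∨
      (p₁ = σ * q₁' ∧ p₂ = σ * q₂' ∧ q₁ = τ * p₁' ∧ q₂ = τ * p₂'))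

theorem SamePair.symm {p₁ p₂ q₁ q₂ p₁' p₂' q₁' q₂' : ℤ}
    (h : SamePair p₁ p₂ q₁ q₂ p₁' p₂' q₁' q₂') : SamePair p₁' p₂' q₁' q₂' p₁ p₂ q₁ q₂ := by
  obtain ⟨σ, τ, rfl | rfl, rfl | rfl, ⟨rfl, rfl, rfl, rfl⟩ | ⟨rfl, rfl, rfl, rfl⟩⟩ := h
  · exact ⟨1, 1, by simp⟩
  · exact ⟨1, 1, by simp⟩
  · exact ⟨1, -1, by simp⟩
  · exact ⟨-1, 1, by simp⟩
  · exact ⟨-1, 1, by simp⟩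
  · exact ⟨1, -1, by simp⟩
  · exact ⟨-1, -1, by simp⟩
  · exact ⟨-1, -1, by simp⟩

theorem SamePair.diagonals {a b c d a' b' c' d' : ℤ} (h : SamePair a b c d a' b' c' d') :
    SamePair (a + c) (b + d) (a - c) (b - d) (a' + c') (b' + d') (a' - c') (b' - d') := by
  obtain ⟨σ, τ, rfl | rfl, rfl | rfl, ⟨rfl, rfl, rfl, rfl⟩ | ⟨rfl, rfl, rfl, rfl⟩⟩ := h
  · exact ⟨1, 1, by simp, by simp, Or.inl (by refine ⟨?_, ?_, ?_, ?_⟩ <;> ring)⟩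
  · exact ⟨1, -1, by simp, by simp, Or.inl (by refine ⟨?_, ?_, ?_, ?_⟩ <;> ring)⟩
  · exact ⟨1, 1, by simp, by simp, Or.inr (by refine ⟨?_, ?_, ?_, ?_⟩ <;> ring)⟩
  · exact ⟨-1, 1, by simp, by simp, Or.inr (by refine ⟨?_, ?_, ?_, ?_⟩ <;> ring)⟩
  · exact ⟨-1, -1, by simp, by simp, Or.inr (by refine ⟨?_, ?_, ?_, ?_⟩ <;> ring)⟩
  · exact ⟨1, -1, by simp, by simp, Or.inr (by refine ⟨?_, ?_, ?_, ?_⟩ <;> ring)⟩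
  · exact ⟨-1, -1, by simp, by simp, Or.inl (by refine ⟨?_, ?_, ?_, ?_⟩ <;> ring)⟩
  · exact ⟨-1, 1, by simp, by simp, Or.inl (by refine ⟨?_, ?_, ?_, ?_⟩ <;> ring)⟩

/-- Taking diagonals twice returns 2x and 2y. -/
theorem SamePair.of_diagonals {a b c d a' b' c' d' : ℤ}
    (h : SamePair (a + c) (b + d) (a - c) (b - d) (a' + c') (b' + d') (a' - c') (b' - d')) :
    SamePair a b c d a' b' c' d' := by
  obtain ⟨σ, τ, hσ, hτ, h' | h'⟩ := h.diagonals
  · exact ⟨σ, τ, hσ, hτ, Or.inl (by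
      refine ⟨?_, ?_, ?_, ?_⟩ <;> linarith [h'.1, h'.2.1, h'.2.2.1, h'.2.2.2])⟩
  · exact ⟨σ, τ, hσ, hτ, Or.inr (by
      refine ⟨?_, ?_, ?_, ?_⟩ <;> linarith [h'.1, h'.2.1, h'.2.2.1, h'.2.2.2])⟩

theorem SamePair.pairLattice_le {a b c d a' b' c' d' : ℤ} (h : SamePair a b c d a' b' c' d') :
    pairLattice a b c d ≤ pairLattice a' b' c' d' := by
  obtain ⟨σ, τ, -, -, ⟨rfl, rfl, rfl, rfl⟩ | ⟨rfl, rfl, rfl, rfl⟩⟩ := h <;>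
    rw [pairLattice, Submodule.span_le] <;> rintro z (rfl | rfl) <;>
    rw [SetLike.mem_coe, mem_pairLattice]
  · exact ⟨σ, 0, by simp⟩
  · exact ⟨0, τ, by simp⟩
  · exact ⟨0, σ, by simp⟩
  · exact ⟨τ, 0, by simp⟩

theorem SamePair.pairLattice_eq {a b c d a' b' c' d' : ℤ} (h : SamePair a b c d a' b' c' d') :
    pairLattice a b c d = pairLattice a' b' c' d' :=
  le_antisymm h.pairLattice_le h.symm.pairLattice_le

/-! ### Parametrization of balanced orthogonal pairs. -/

/-- Parameters `(k, l, r, s)` of the orthogonal pair `k (r, s)`, `l (-s, r)`. -/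
structure IsOrthParam (t k l r s : ℕ) : Prop where
  k_pos : 0 < k
  l_pos : 0 < l
  r_pos : 0 < r
  gcd_eq : Nat.gcd r s = 1
  mul_eq : k * l * (r ^ 2 + s ^ 2) = t
  k_le : k ^ 2 ≤ 3 * l ^ 2
  l_le : l ^ 2 ≤ 3 * k ^ 2

theorem IsOrthParam.isBalancedOrth {t k l r s : ℕ} (h : IsOrthParam t k l r s) :
    IsBalancedOrth t (k * r) (k * s) (-(l * s)) (l * r) := by
  obtain ⟨-, -, -, -, h1, h2, h3⟩ := h
  zify at h1 h2 h3
  refine ⟨by ring, ?_, ?_, ?_⟩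
  · rw [← h1, abs_eq_self.2]
    · ring
    · have : (0 : ℤ) ≤ k * l * (r ^ 2 + s ^ 2) := by positivity
      linarith
  · nlinarith [mul_le_mul_of_nonneg_right h2 (by positivity : (0 : ℤ) ≤ r ^ 2 + s ^ 2)]
  · nlinarith [mul_le_mul_of_nonneg_right h3 (by positivity : (0 : ℤ) ≤ r ^ 2 + s ^ 2)]

/-- Among ±k(r, s), ±l(-s, r) only k(r, s) lies in the half-open quadrant of positive first and
nonnegative second coordinate. This rules out swaps and sign changes, and k is then the gcd of the
coordinates. -/
theorem IsOrthParam.eq_of_samePair {t k l r s k' l' r' s' : ℕ} (h : IsOrthParam t k l r s)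
    (h' : IsOrthParam t k' l' r' s')
    (hs : SamePair (k * r) (k * s) (-(l * s)) (l * r) (k' * r') (k' * s') (-(l' * s')) (l' * r')) :
    k = k' ∧ l = l' ∧ r = r' ∧ s = s' := by
  have hk := h.k_pos
  have hl := h.l_pos
  have hr := h.r_pos
  have hk' := h'.k_pos
  have hl' := h'.l_pos
  have hr' := h'.r_pos
  have e1 : (0 : ℤ) < k * r := by positivity
  have e2 : (0 : ℤ) ≤ k * s := by positivity
  have e3 : (0 : ℤ) < l * r := by positivity
  have f1 : (0 : ℤ) < k' * r' := by positivity
  have f2 : (0 : ℤ) ≤ l' * s' := by positivity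
  have f3 : (0 : ℤ) < l' * r' := by positivity
  obtain ⟨σ, τ, hσ, hτ, ⟨a1, a2, -, a4⟩ | ⟨a1, a2, -, -⟩⟩ := hs
  · have hσ1 : σ = 1 := by
      rcases hσ with rfl | rfl
      · rfl
      · linarith
    have hτ1 : τ = 1 := by
      rcases hτ with rfl | rfl
      · rfl
      · linarith
    subst hσ1 hτ1
    rw [one_mul] at a1 a2 a4
    norm_cast at a1 a2 a4
    have hkk : k = k' := by
      have := congrArg₂ Nat.gcd a1 a2
      rwa [Nat.gcd_mul_left, Nat.gcd_mul_left, h.gcd_eq, h'.gcd_eq, mul_one, mul_one] at this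
    subst hkk
    have hrr := Nat.eq_of_mul_eq_mul_left hk a1
    have hss := Nat.eq_of_mul_eq_mul_left hk a2
    subst hrr
    exact ⟨rfl, Nat.eq_of_mul_eq_mul_right hr a4, rfl, hss⟩
  · rcases hσ with rfl | rfl <;> linarith

theorem IsBalancedOrth.neg_left {t p₁ p₂ q₁ q₂ : ℤ} (h : IsBalancedOrth t p₁ p₂ q₁ q₂) :
    IsBalancedOrth t (-p₁) (-p₂) q₁ q₂ := by
  obtain ⟨h1, h2, h3, h4⟩ := h
  refine ⟨by linarith, ?_, by linarith, by linarith⟩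
  rw [← h2, ← abs_neg]; congr 1; ring

theorem IsBalancedOrth.swap {t p₁ p₂ q₁ q₂ : ℤ} (h : IsBalancedOrth t p₁ p₂ q₁ q₂) :
    IsBalancedOrth t q₁ q₂ p₁ p₂ := by
  obtain ⟨h1, h2, h3, h4⟩ := h
  refine ⟨by linarith, ?_, by linarith, by linarith⟩
  rw [← h2, ← abs_neg]; congr 1; ring

theorem IsBalancedOrth.exists_param_of_pos {t : ℕ} (ht : 0 < t) {p₁ p₂ q₁ q₂ : ℤ}
    (h : IsBalancedOrth t p₁ p₂ q₁ q₂) (h1 : 0 < p₁) (h2 : 0 ≤ p₂) :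
    ∃ k l r s : ℕ, IsOrthParam t k l r s ∧ p₁ = k * r ∧ p₂ = k * s ∧
      ∃ τ : ℤ, (τ = 1 ∨ τ = -1) ∧ q₁ = τ * (-(l * s)) ∧ q₂ = τ * (l * r) := by
  lift p₁ to ℕ using h1.le
  lift p₂ to ℕ using h2
  have h1' : 0 < p₁ := by exact_mod_cast h1
  obtain ⟨k, r, s, hk, hrs, rfl, rfl⟩ := Nat.exists_coprime' (m := p₁) (n := p₂)
    (Nat.gcd_pos_of_pos_left _ h1')
  have hr : 0 < r := Nat.pos_of_mul_pos_right h1'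
  have hk' : (k : ℤ) ≠ 0 := by exact_mod_cast hk.ne'
  have hin : (r : ℤ) * q₁ + s * q₂ = 0 := by
    have := h.inner_eq
    push_cast at this
    exact (mul_eq_zero.1 (by linear_combination this :
      (k : ℤ) * ((r : ℤ) * q₁ + s * q₂) = 0)).resolve_left hk'
  -- Orthogonality to the primitive vector (r, s) forces q = L(-s, r); then l = |L| and τ is the
  -- sign of L.
  have hdvd : (r : ℤ) ∣ q₂ := by
    have hcop : IsCoprime (r : ℤ) s := Nat.isCoprime_iff_coprime.2 hrs
    exact hcop.dvd_of_dvd_mul_left ⟨-q₁, by linarith⟩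
  obtain ⟨L, rfl⟩ := hdvd
  have hr0 : (r : ℤ) ≠ 0 := by exact_mod_cast hr.ne'
  have hq₁ : q₁ = -(s * L) := by
    have : (r : ℤ) * (q₁ + s * L) = 0 := by linear_combination hin
    linarith [(mul_eq_zero.1 this).resolve_left hr0]
  subst hq₁
  have hN : (0 : ℤ) < r ^ 2 + s ^ 2 := by positivity
  have hdet := h.abs_det
  push_cast at hdet
  rw [show (r : ℤ) * k * (r * L) - s * k * -(s * L) = k * (r ^ 2 + s ^ 2) * L by ring, abs_mul,
    abs_of_nonneg (by positivity), Int.abs_eq_natAbs] at hdet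
  have hL : 0 < L.natAbs := by
    rw [Nat.pos_iff_ne_zero]
    intro h0
    rw [h0] at hdet
    simp at hdet
    omega
  have hle := h.left_le
  have hge := h.right_le
  push_cast at hle hge
  refine ⟨k, L.natAbs, r, s, ⟨hk, hL, hr, hrs, ?_, ?_, ?_⟩, by push_cast; ring, by push_cast; ring,
    L.sign, ?_, ?_, ?_⟩
  · zify; rw [← Int.abs_eq_natAbs] at *; linarith
  · zify; rw [sq_abs]
    refine le_of_mul_le_mul_right ?_ hN
    linarith
  · zify; rw [sq_abs]
    refine le_of_mul_le_mul_right ?_ hN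
    linarith
  · rcases lt_trichotomy L 0 with h0 | h0 | h0
    · exact Or.inr (Int.sign_eq_neg_one_of_neg h0)
    · simp [h0] at hL
    · exact Or.inl (Int.sign_eq_one_of_pos h0)
  · linear_combination (s : ℤ) * Int.sign_mul_natAbs L
  · linear_combination -(r : ℤ) * Int.sign_mul_natAbs L

theorem IsBalancedOrth.exists_param_samePair {t : ℕ} (ht : 0 < t) {p₁ p₂ q₁ q₂ : ℤ}
    (h : IsBalancedOrth t p₁ p₂ q₁ q₂) :
    ∃ k l r s : ℕ, IsOrthParam t k l r s ∧
      SamePair p₁ p₂ q₁ q₂ (k * r) (k * s) (-(l * s)) (l * r) := by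
  -- The vectors ±p, ±q point in four perpendicular directions, so one of them meets the half-open
  -- quadrant.
  have key : (0 < p₁ ∧ 0 ≤ p₂) ∨ (0 < -p₁ ∧ 0 ≤ -p₂) ∨ (0 < q₁ ∧ 0 ≤ q₂) ∨
      (0 < -q₁ ∧ 0 ≤ -q₂) := by
    have hin := h.inner_eq
    have hdet : p₁ * q₂ - p₂ * q₁ ≠ 0 := by
      rw [← abs_pos, h.abs_det]; exact_mod_cast ht
    by_contra! hc
    obtain ⟨c1, c2, c3, c4⟩ := hc
    rcases lt_trichotomy p₁ 0 with hp | hp | hp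
    · have hp2 : 0 < p₂ := by linarith [c2 (by linarith)]
      rcases lt_trichotomy q₁ 0 with hq | hq | hq
      · nlinarith [c4 (by linarith), mul_pos_of_neg_of_neg hp hq]
      · subst hq
        have : q₂ = 0 := by
          simp at hin
          omega
        simp [this] at hdet
      · nlinarith [c3 hq, mul_pos (neg_pos.2 hp) hq]
    · subst hp
      have hp2 : p₂ ≠ 0 := by rintro rfl; simp at hdet
      have hq2 : q₂ = 0 := by simpa [hp2] using hin
      subst hq2
      rcases lt_trichotomy q₁ 0 with hq | hq | hq
      · simpa using c4 (by linarith)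
      · simp [hq] at hdet
      · simpa using c3 hq
    · have hp2 : p₂ < 0 := c1 hp
      rcases lt_trichotomy q₁ 0 with hq | hq | hq
      · nlinarith [c4 (by linarith), mul_pos hp (neg_pos.2 hq)]
      · subst hq
        have : q₂ = 0 := by
          simp at hin
          omega
        simp [this] at hdet
      · nlinarith [c3 hq, mul_pos hp hq]
  rcases key with ⟨h1, h2⟩ | ⟨h1, h2⟩ | ⟨h1, h2⟩ | ⟨h1, h2⟩
  · obtain ⟨k, l, r, s, hp, e1, e2, τ, hτ, e3, e4⟩ := h.exists_param_of_pos ht h1 h2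
    exact ⟨k, l, r, s, hp, 1, τ, by simp, hτ, Or.inl ⟨by linarith, by linarith, e3, e4⟩⟩
  · obtain ⟨k, l, r, s, hp, e1, e2, τ, hτ, e3, e4⟩ := h.neg_left.exists_param_of_pos ht h1 h2
    exact ⟨k, l, r, s, hp, -1, τ, by simp, hτ, Or.inl ⟨by linarith, by linarith, e3, e4⟩⟩
  · obtain ⟨k, l, r, s, hp, e1, e2, τ, hτ, e3, e4⟩ := h.swap.exists_param_of_pos ht h1 h2
    exact ⟨k, l, r, s, hp, τ, 1, hτ, by simp, Or.inr ⟨e3, e4, by linarith, by linarith⟩⟩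
  · obtain ⟨k, l, r, s, hp, e1, e2, τ, hτ, e3, e4⟩ := h.swap.neg_left.exists_param_of_pos ht h1 h2
    exact ⟨k, l, r, s, hp, τ, -1, hτ, by simp, Or.inr ⟨e3, e4, by linarith, by linarith⟩⟩

/-! ### Bijection between parameters and lattices of determinant `u`. -/

/-- The well-rounded lattice with diagonals `c k (r, s)` and `c l (-s, r)`, where `c` is `2` for
even `u` and `1 + i` for odd `u`. -/
noncomputable def paramLattice (u k l r s : ℕ) : Submodule ℤ (EuclideanSpace ℝ (Fin 2)) :=
  if Even u then pairLattice (k * r - l * s) (k * s + l * r) (k * r + l * s) (k * s - l * r)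
  else pairLattice ((k - l) / 2 * r - (k + l) / 2 * s) ((k - l) / 2 * s + (k + l) / 2 * r)
    ((k + l) / 2 * r - (k - l) / 2 * s) ((k + l) / 2 * s + (k - l) / 2 * r)

theorem SamePair.of_mul_two {p₁ p₂ q₁ q₂ p₁' p₂' q₁' q₂' : ℤ}
    (h : SamePair (2 * p₁) (2 * p₂) (2 * q₁) (2 * q₂) (2 * p₁') (2 * p₂') (2 * q₁') (2 * q₂')) :
    SamePair p₁ p₂ q₁ q₂ p₁' p₂' q₁' q₂' := by
  obtain ⟨σ, τ, hσ, hτ, h' | h'⟩ := h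
  · exact ⟨σ, τ, hσ, hτ, Or.inl (by
      refine ⟨?_, ?_, ?_, ?_⟩ <;> linarith [h'.1, h'.2.1, h'.2.2.1, h'.2.2.2])⟩
  · exact ⟨σ, τ, hσ, hτ, Or.inr (by
      refine ⟨?_, ?_, ?_, ?_⟩ <;> linarith [h'.1, h'.2.1, h'.2.2.1, h'.2.2.2])⟩

theorem SamePair.mul_two {p₁ p₂ q₁ q₂ p₁' p₂' q₁' q₂' : ℤ}
    (h : SamePair p₁ p₂ q₁ q₂ p₁' p₂' q₁' q₂') :
    SamePair (2 * p₁) (2 * p₂) (2 * q₁) (2 * q₂) (2 * p₁') (2 * p₂') (2 * q₁') (2 * q₂') := by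
  obtain ⟨σ, τ, hσ, hτ, h' | h'⟩ := h
  · exact ⟨σ, τ, hσ, hτ, Or.inl (by
      refine ⟨?_, ?_, ?_, ?_⟩ <;> linarith [h'.1, h'.2.1, h'.2.2.1, h'.2.2.2])⟩
  · exact ⟨σ, τ, hσ, hτ, Or.inr (by
      refine ⟨?_, ?_, ?_, ?_⟩ <;> linarith [h'.1, h'.2.1, h'.2.2.1, h'.2.2.2])⟩

theorem SamePair.rotate {p₁ p₂ q₁ q₂ p₁' p₂' q₁' q₂' : ℤ}
    (h : SamePair p₁ p₂ q₁ q₂ p₁' p₂' q₁' q₂') :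
    SamePair (p₁ - p₂) (p₁ + p₂) (q₁ - q₂) (q₁ + q₂)
      (p₁' - p₂') (p₁' + p₂') (q₁' - q₂') (q₁' + q₂') := by
  obtain ⟨σ, τ, hσ, hτ, h' | h'⟩ := h
  · exact ⟨σ, τ, hσ, hτ, Or.inl (by
      refine ⟨?_, ?_, ?_, ?_⟩ <;> linarith [h'.1, h'.2.1, h'.2.2.1, h'.2.2.2])⟩
  · exact ⟨σ, τ, hσ, hτ, Or.inr (by
      refine ⟨?_, ?_, ?_, ?_⟩ <;> linarith [h'.1, h'.2.1, h'.2.2.1, h'.2.2.2])⟩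

theorem SamePair.of_rotate {p₁ p₂ q₁ q₂ p₁' p₂' q₁' q₂' : ℤ}
    (h : SamePair (p₁ - p₂) (p₁ + p₂) (q₁ - q₂) (q₁ + q₂)
      (p₁' - p₂') (p₁' + p₂') (q₁' - q₂') (q₁' + q₂')) :
    SamePair p₁ p₂ q₁ q₂ p₁' p₂' q₁' q₂' := by
  obtain ⟨σ, τ, hσ, hτ, h' | h'⟩ := h
  · exact ⟨σ, τ, hσ, hτ, Or.inl (by
      refine ⟨?_, ?_, ?_, ?_⟩ <;> linarith [h'.1, h'.2.1, h'.2.2.1, h'.2.2.2])⟩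
  · exact ⟨σ, τ, hσ, hτ, Or.inr (by
      refine ⟨?_, ?_, ?_, ?_⟩ <;> linarith [h'.1, h'.2.1, h'.2.2.1, h'.2.2.2])⟩

/-- Modulo 4 the norm counts odd coordinates, so both vectors have equally many. If each has just
one, an even determinant puts it in the same position. -/
theorem even_sub_of_norm_eq_of_even_det {a b c d : ℤ} (hn : a ^ 2 + b ^ 2 = c ^ 2 + d ^ 2)
    (hD : Even (a * d - b * c)) : Even (a - c) ∧ Even (b - d) := by
  have key : ∀ x : ℤ, ∃ y : ℤ, x ^ 2 = 4 * y ∧ Even x ∨ x ^ 2 = 4 * y + 1 ∧ Odd x := by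
    intro x
    rcases Int.even_or_odd x with h | h
    · obtain ⟨y, rfl⟩ := h
      exact ⟨y ^ 2, Or.inl ⟨by ring, ⟨y, rfl⟩⟩⟩
    · obtain ⟨y, rfl⟩ := h
      exact ⟨y ^ 2 + y, Or.inr ⟨by ring, ⟨y, rfl⟩⟩⟩
  obtain ⟨a', ha⟩ := key a
  obtain ⟨b', hb⟩ := key b
  obtain ⟨c', hc⟩ := key c
  obtain ⟨d', hd⟩ := key d
  rw [Int.even_sub, Int.even_mul, Int.even_mul] at hD
  rw [Int.even_sub, Int.even_sub]
  simp only [← Int.not_even_iff_odd] at ha hb hc hd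
  rcases ha with ⟨ha, ha'⟩ | ⟨ha, ha'⟩ <;> rcases hb with ⟨hb, hb'⟩ | ⟨hb, hb'⟩ <;>
    rcases hc with ⟨hc, hc'⟩ | ⟨hc, hc'⟩ <;> rcases hd with ⟨hd, hd'⟩ | ⟨hd, hd'⟩ <;>
    simp only [ha', hb', hc', hd'] at hD ⊢ <;> simp at hD ⊢ <;> omega

theorem even_add_of_norm_eq {a b c d : ℤ} (hn : a ^ 2 + b ^ 2 = c ^ 2 + d ^ 2) :
    Even (a + b + c + d) := by
  have h : Even (a ^ 2 + b ^ 2) ↔ Even (c ^ 2 + d ^ 2) := by rw [hn]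
  simp only [Int.even_add, Int.even_pow' two_ne_zero] at h ⊢
  tauto

/-- Every lattice of `paramLattice` is spanned by a minimal pair with the given diagonals. -/
theorem exists_minimalPair_paramLattice {u k l r s : ℕ} (hu : 0 < u)
    (h : IsOrthParam (tOf u) k l r s) :
    ∃ a b c d : ℤ, IsMinimalPair a b c d ∧ |a * d - b * c| = u ∧
      paramLattice u k l r s = pairLattice a b c d ∧
      ((Even u ∧ a + c = 2 * (k * r) ∧ b + d = 2 * (k * s) ∧ a - c = 2 * (-(l * s)) ∧
          b - d = 2 * (l * r)) ∨
        (¬ Even u ∧ a + c = k * r - k * s ∧ b + d = k * r + k * s ∧ a - c = -(l * s) - l * r ∧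
          b - d = -(l * s) + l * r)) := by
  have hb := h.isBalancedOrth
  have hu' : (0 : ℤ) < u := by exact_mod_cast hu
  by_cases he : Even u
  · have ht : (u : ℤ) = 2 * (tOf u : ℕ) := by
      rw [tOf, if_pos he]
      have := Nat.two_mul_div_two_of_even he
      omega
    have key := isBalancedOrth_two_mul_iff.2 hb
    rw [← ht] at key
    have hd : ((k : ℤ) * r - l * s) + (k * r + l * s) = 2 * (k * r) ∧
        ((k : ℤ) * s + l * r) + (k * s - l * r) = 2 * (k * s) ∧
        ((k : ℤ) * r - l * s) - (k * r + l * s) = 2 * (-(l * s)) ∧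
        ((k : ℤ) * s + l * r) - (k * s - l * r) = 2 * (l * r) := by
      refine ⟨?_, ?_, ?_, ?_⟩ <;> ring
    rw [← hd.1, ← hd.2.1, ← hd.2.2.1, ← hd.2.2.2, ← isMinimalPair_and_iff hu'] at key
    exact ⟨_, _, _, _, key.1, key.2, by rw [paramLattice, if_pos he], Or.inl ⟨he, hd⟩⟩
  · have ht : tOf u = u := by rw [tOf, if_neg he]
    -- Both factors divide the odd number u, so the halves (k ± l)/2 in `paramLattice` are exact.
    have hodd : Odd k ∧ Odd l := by
      have h1 := h.mul_eq
      rw [ht] at h1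
      rw [← h1, Nat.even_mul, Nat.even_mul] at he
      simp only [← Nat.not_even_iff_odd]
      tauto
    have key := isBalancedOrth_rotate_iff.2 hb
    rw [ht] at key
    obtain ⟨⟨x, hx⟩, ⟨y, hy⟩⟩ := hodd
    have e1 : ((k : ℤ) - l) / 2 = x - y := by omega
    have e2 : ((k : ℤ) + l) / 2 = x + y + 1 := by omega
    have hk : (k : ℤ) = 2 * x + 1 := by omega
    have hl : (l : ℤ) = 2 * y + 1 := by omega
    have hd : (((k : ℤ) - l) / 2 * r - (k + l) / 2 * s) + ((k + l) / 2 * r - (k - l) / 2 * s) =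
          k * r - k * s ∧
        (((k : ℤ) - l) / 2 * s + (k + l) / 2 * r) + ((k + l) / 2 * s + (k - l) / 2 * r) =
          k * r + k * s ∧
        (((k : ℤ) - l) / 2 * r - (k + l) / 2 * s) - ((k + l) / 2 * r - (k - l) / 2 * s) =
          -(l * s) - l * r ∧
        (((k : ℤ) - l) / 2 * s + (k + l) / 2 * r) - ((k + l) / 2 * s + (k - l) / 2 * r) =
          -(l * s) + l * r := by
      rw [e1, e2, hk, hl]
      refine ⟨?_, ?_, ?_, ?_⟩ <;> ring
    rw [← hd.1, ← hd.2.1, ← hd.2.2.1, ← hd.2.2.2, ← isMinimalPair_and_iff hu'] at key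
    exact ⟨_, _, _, _, key.1, key.2, by rw [paramLattice, if_neg he], Or.inr ⟨he, hd⟩⟩

theorem paramLattice_mem_WRdet {u k l r s : ℕ} (hu : 0 < u)
    (h : IsOrthParam (tOf u) k l r s) : paramLattice u k l r s ∈ WRdet intLattice u := by
  obtain ⟨a, b, c, d, h1, h2, h3, -⟩ := exists_minimalPair_paramLattice hu h
  rw [WRdet_intLattice]
  exact ⟨a, b, c, d, h1, by rw [h2]; simp, h3⟩

theorem paramLattice_injective {u k l r s k' l' r' s' : ℕ} (hu : 0 < u)
    (h : IsOrthParam (tOf u) k l r s) (h' : IsOrthParam (tOf u) k' l' r' s')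
    (he : paramLattice u k l r s = paramLattice u k' l' r' s') :
    k = k' ∧ l = l' ∧ r = r' ∧ s = s' := by
  obtain ⟨a, b, c, d, h1, -, h3, h4⟩ := exists_minimalPair_paramLattice hu h
  obtain ⟨a', b', c', d', h1', -, h3', h4'⟩ := exists_minimalPair_paramLattice hu h'
  rw [h3, h3'] at he
  have hs : SamePair a b c d a' b' c' d' := h1.eq_of_pairLattice_eq h1' he
  replace hs := hs.diagonals
  apply h.eq_of_samePair h'
  rcases h4 with ⟨hu, e1, e2, e3, e4⟩ | ⟨hu, e1, e2, e3, e4⟩ <;>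
    rcases h4' with ⟨hu', e1', e2', e3', e4'⟩ | ⟨hu', e1', e2', e3', e4'⟩
  · rw [e1, e2, e3, e4, e1', e2', e3', e4'] at hs
    exact hs.of_mul_two
  · exact absurd hu hu'
  · exact absurd hu' hu
  · rw [e1, e2, e3, e4, e1', e2', e3', e4'] at hs
    exact hs.of_rotate

theorem tOf_pos {u : ℕ} (hu : 0 < u) : 0 < tOf u := by
  unfold tOf
  split_ifs with h
  · obtain ⟨v, rfl⟩ := h; omega
  · exact hu

theorem exists_paramLattice_eq {u : ℕ} (hu : 0 < u) {Λ : Submodule ℤ (EuclideanSpace ℝ (Fin 2))}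
    (hΛ : Λ ∈ WRdet intLattice u) :
    ∃ k l r s : ℕ, IsOrthParam (tOf u) k l r s ∧ paramLattice u k l r s = Λ := by
  rw [WRdet_intLattice] at hΛ
  obtain ⟨a, b, c, d, h, hD, rfl⟩ := hΛ
  have hD' : |a * d - b * c| = (u : ℤ) := by exact_mod_cast hD
  have hu' : (0 : ℤ) < u := by exact_mod_cast hu
  have hb := (isMinimalPair_and_iff hu').1 ⟨h, hD'⟩
  by_cases he : Even u
  · have ht : (u : ℤ) = 2 * (tOf u : ℕ) := by
      rw [tOf, if_pos he]
      have := Nat.two_mul_div_two_of_even he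
      omega
    have heD : Even (a * d - b * c) := by
      rw [← even_abs, hD']; exact_mod_cast he
    obtain ⟨⟨q₁, h1⟩, ⟨q₂, h2⟩⟩ := even_sub_of_norm_eq_of_even_det h.norm_eq heD
    have e1 : a + c = 2 * (a - q₁) := by linarith
    have e2 : b + d = 2 * (b - q₂) := by linarith
    have e3 : a - c = 2 * q₁ := by linarith
    have e4 : b - d = 2 * q₂ := by linarith
    rw [e1, e2, e3, e4, ht, isBalancedOrth_two_mul_iff] at hb
    obtain ⟨k, l, r, s, hp, hs⟩ := hb.exists_param_samePair (tOf_pos hu)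
    refine ⟨k, l, r, s, hp, ?_⟩
    obtain ⟨a', b', c', d', -, -, h3, ⟨-, f1, f2, f3, f4⟩ | ⟨hne, -⟩⟩ :=
      exists_minimalPair_paramLattice hu hp
    · rw [h3, eq_comm]
      apply (SamePair.of_diagonals ?_).pairLattice_eq
      rw [e1, e2, e3, e4, f1, f2, f3, f4]
      exact hs.mul_two
    · exact absurd he hne
  · have ht : (u : ℤ) = (tOf u : ℕ) := by rw [tOf, if_neg he]
    obtain ⟨x, hx⟩ := even_add_of_norm_eq h.norm_eq
    -- With x half the sum of all coordinates, (x, y) and (x - c - d, b + c - x) are the diagonals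
    -- divided by 1 + i.
    obtain ⟨y, hy⟩ : ∃ y, b + d = x + y := ⟨b + d - x, by ring⟩
    have e1 : a + c = x - y := by linarith
    have e3 : a - c = (x - c - d) - (b + c - x) := by linarith
    have e4 : b - d = (x - c - d) + (b + c - x) := by linarith
    rw [e1, hy, e3, e4, ht, isBalancedOrth_rotate_iff] at hb
    obtain ⟨k, l, r, s, hp, hs⟩ := hb.exists_param_samePair (tOf_pos hu)
    refine ⟨k, l, r, s, hp, ?_⟩
    obtain ⟨a', b', c', d', -, -, h3, ⟨he', -⟩ | ⟨-, f1, f2, f3, f4⟩⟩ :=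
      exists_minimalPair_paramLattice hu hp
    · exact absurd he' he
    · rw [h3, eq_comm]
      apply (SamePair.of_diagonals ?_).pairLattice_eq
      rw [e1, hy, e3, e4, f1, f2, f3, f4]
      exact hs.rotate

/-! ### Counting the parameters. -/

/-- Factorizations `n = k l` whose factors have ratio between `1 / √3` and `√3`. -/
def balancedFactorizations (n : ℕ) : Finset (ℕ × ℕ) :=
  n.divisorsAntidiagonal.filter (fun p => p.1 ^ 2 ≤ 3 * p.2 ^ 2 ∧ p.2 ^ 2 ≤ 3 * p.1 ^ 2)

/-- Primitive vectors `(r, s)` with `r > 0` and `s ≥ 0` of squared length `N`. -/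
def primitiveVectors (N : ℕ) : Finset (ℕ × ℕ) :=
  (Finset.range (N + 1) ×ˢ Finset.range (N + 1)).filter
    (fun p => p.1 ^ 2 + p.2 ^ 2 = N ∧ 0 < p.1 ∧ Nat.gcd p.1 p.2 = 1)

theorem mem_primitiveVectors {N : ℕ} {p : ℕ × ℕ} :
    p ∈ primitiveVectors N ↔ p.1 ^ 2 + p.2 ^ 2 = N ∧ 0 < p.1 ∧ Nat.gcd p.1 p.2 = 1 := by
  rw [primitiveVectors, Finset.mem_filter, Finset.mem_product, Finset.mem_range, Finset.mem_range,
    and_iff_right_iff_imp]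
  rintro ⟨h, -, -⟩
  constructor <;> nlinarith [Nat.le_self_pow two_ne_zero p.1, Nat.le_self_pow two_ne_zero p.2]

/-- The parameters `(k, l, r, s)` of the well-rounded lattices, grouped by `n = k l`. -/
def orthParams (t : ℕ) : Finset (Σ _ : ℕ, (ℕ × ℕ) × (ℕ × ℕ)) :=
  t.divisors.sigma fun n => balancedFactorizations n ×ˢ primitiveVectors (t / n)

theorem isOrthParam_of_mem_orthParams {t : ℕ} {x : Σ _ : ℕ, (ℕ × ℕ) × (ℕ × ℕ)}
    (hx : x ∈ orthParams t) :
    IsOrthParam t x.2.1.1 x.2.1.2 x.2.2.1 x.2.2.2 ∧ x.1 = x.2.1.1 * x.2.1.2 := by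
  obtain ⟨n, ⟨k, l⟩, ⟨r, s⟩⟩ := x
  simp only [orthParams, balancedFactorizations, Finset.mem_sigma, Finset.mem_product,
    Finset.mem_filter, Nat.mem_divisorsAntidiagonal, mem_primitiveVectors, Nat.mem_divisors] at hx
  obtain ⟨⟨hn, ht⟩, ⟨⟨rfl, hn0⟩, h1, h2⟩, h3, h4, h5⟩ := hx
  exact ⟨⟨Nat.pos_of_ne_zero (left_ne_zero_of_mul hn0), Nat.pos_of_ne_zero
    (right_ne_zero_of_mul hn0), h4, h5, by simp only [h3]; exact Nat.mul_div_cancel' hn, h1, h2⟩,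
    rfl⟩

theorem mem_orthParams_of_isOrthParam {t k l r s : ℕ} (ht : 0 < t) (h : IsOrthParam t k l r s) :
    (⟨k * l, (k, l), (r, s)⟩ : Σ _ : ℕ, (ℕ × ℕ) × (ℕ × ℕ)) ∈ orthParams t := by
  have hkl : 0 < k * l := Nat.mul_pos h.k_pos h.l_pos
  simp only [orthParams, balancedFactorizations, Finset.mem_sigma, Finset.mem_product,
    Finset.mem_filter, Nat.mem_divisorsAntidiagonal, mem_primitiveVectors, Nat.mem_divisors]
  refine ⟨⟨⟨_, h.mul_eq.symm⟩, ht.ne'⟩, ⟨⟨trivial, hkl.ne'⟩, h.k_le, h.l_le⟩, ?_, h.r_pos, h.gcd_eq⟩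
  rw [← h.mul_eq, Nat.mul_div_cancel_left _ hkl]

theorem WRdet_intLattice_eq_image {u : ℕ} (hu : 0 < u) :
    WRdet intLattice u =
      (fun x : Σ _ : ℕ, (ℕ × ℕ) × (ℕ × ℕ) => paramLattice u x.2.1.1 x.2.1.2 x.2.2.1 x.2.2.2) ''
        (orthParams (tOf u) : Set (Σ _ : ℕ, (ℕ × ℕ) × (ℕ × ℕ))) := by
  ext Λ
  constructor
  · intro hΛ
    obtain ⟨k, l, r, s, h, rfl⟩ := exists_paramLattice_eq hu hΛ
    exact ⟨_, mem_orthParams_of_isOrthParam (tOf_pos hu) h, rfl⟩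
  · rintro ⟨x, hx, rfl⟩
    exact paramLattice_mem_WRdet hu (isOrthParam_of_mem_orthParams hx).1

theorem finite_WRdet_intLattice {u : ℕ} (hu : 0 < u) : (WRdet intLattice u).Finite := by
  rw [WRdet_intLattice_eq_image hu]
  exact (Finset.finite_toSet _).image _

theorem numWR_eq_card {u : ℕ} (hu : 0 < u) : numWR u = (orthParams (tOf u)).card := by
  rw [numWR, WRdet_intLattice_eq_image hu, Set.InjOn.ncard_image, Set.ncard_coe_finset]
  rintro x hx y hy hxy
  obtain ⟨hx1, hx2⟩ := isOrthParam_of_mem_orthParams hx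
  obtain ⟨hy1, hy2⟩ := isOrthParam_of_mem_orthParams hy
  obtain ⟨h1, h2, h3, h4⟩ := paramLattice_injective hu hx1 hy1 hxy
  obtain ⟨n, ⟨k, l⟩, ⟨r, s⟩⟩ := x
  obtain ⟨n', ⟨k', l'⟩, ⟨r', s'⟩⟩ := y
  dsimp only at *
  subst h1 h2 h3 h4 hx2 hy2
  rfl

theorem card_orthParams (t : ℕ) : (orthParams t).card =
    ∑ n ∈ t.divisors, (primitiveVectors (t / n)).card * (balancedFactorizations n).card := by
  simp [orthParams, Finset.card_sigma, Finset.card_product, mul_comm]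

theorem card_orthParams_one : (orthParams 1).card = 1 := by
  rw [card_orthParams]
  decide

/-- Fourth powers turn the lower bound into d²e² ≤ 3d⁴. Hence β(n) counts balanced factorizations of
n with the smaller factor first. -/
theorem sqrt_mul_bounds_iff {d e : ℕ} (hd : 0 < d) :
    (√((d * e : ℕ) : ℝ) / (3 : ℝ) ^ (1 / 4 : ℝ) ≤ d ∧ (d : ℝ) ≤ √((d * e : ℕ) : ℝ)) ↔
      d ≤ e ∧ e ^ 2 ≤ 3 * d ^ 2 := by
  have hd' : (0 : ℝ) < d := by exact_mod_cast hd
  have h4 : ((3 : ℝ) ^ (1 / 4 : ℝ)) ^ 4 = 3 := by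
    rw [← Real.rpow_natCast, ← Real.rpow_mul (by norm_num)]; norm_num
  have hpos : 0 < (3 : ℝ) ^ (1 / 4 : ℝ) := Real.rpow_pos_of_pos (by norm_num) _
  have hs : √((d * e : ℕ) : ℝ) ^ 4 = (d : ℝ) ^ 2 * e ^ 2 := by
    rw [show 4 = 2 * 2 from rfl, pow_mul, Real.sq_sqrt (by positivity)]; push_cast; ring
  rw [and_comm]
  apply and_congr
  · rw [Real.le_sqrt' hd']
    push_cast
    rw [sq, mul_le_mul_iff_right₀ hd', Nat.cast_le]
  · rw [div_le_iff₀ hpos, ← pow_le_pow_iff_left₀ (by positivity) (by positivity) four_ne_zero, hs,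
      mul_pow, h4, show (d : ℝ) ^ 4 * 3 = d ^ 2 * (3 * d ^ 2) by ring,
      mul_le_mul_iff_right₀ (by positivity)]
    exact_mod_cast Iff.rfl

theorem beta_eq_card {n : ℕ} (hn : n ≠ 0) : beta n =
    (n.divisorsAntidiagonal.filter (fun p => p.1 ≤ p.2 ∧ p.2 ^ 2 ≤ 3 * p.1 ^ 2)).card := by
  rw [beta, betaNu]
  refine Finset.card_nbij' (fun d => (d, n / d)) Prod.fst ?_ ?_ ?_ ?_
  · intro d hd
    simp only [Finset.coe_filter, Set.mem_ofPred_eq, Nat.mem_divisors,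
      Nat.mem_divisorsAntidiagonal] at hd ⊢
    obtain ⟨⟨⟨e, rfl⟩, -⟩, h⟩ := hd
    have hd0 := Nat.pos_of_ne_zero (left_ne_zero_of_mul hn)
    rw [Nat.mul_div_cancel_left _ hd0]
    exact ⟨⟨rfl, hn⟩, (sqrt_mul_bounds_iff hd0).1 h⟩
  · rintro ⟨d, e⟩ hd
    simp only [Finset.coe_filter, Set.mem_ofPred_eq, Nat.mem_divisors,
      Nat.mem_divisorsAntidiagonal] at hd ⊢
    obtain ⟨⟨rfl, -⟩, h⟩ := hd
    exact ⟨⟨dvd_mul_right _ _, hn⟩,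
      (sqrt_mul_bounds_iff (Nat.pos_of_ne_zero (left_ne_zero_of_mul hn))).2 h⟩
  · intro d _
    rfl
  · rintro ⟨d, e⟩ hd
    simp only [Finset.coe_filter, Set.mem_ofPred_eq, Nat.mem_divisorsAntidiagonal] at hd
    obtain ⟨⟨rfl, h⟩, -⟩ := hd
    simp only [Prod.mk.injEq, true_and]
    exact Nat.mul_div_cancel_left _ (Nat.pos_of_ne_zero (left_ne_zero_of_mul h))

/-- The factorizations with k ≤ l and those with l ≤ k are β(n) each; they overlap only in k = l,
which occurs when n is a square. -/
theorem card_balancedFactorizations {n : ℕ} (hn : n ≠ 0) :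
    ((balancedFactorizations n).card : ℚ) = gammaTerm n := by
  set S := n.divisorsAntidiagonal.filter (fun p => p.1 ≤ p.2 ∧ p.2 ^ 2 ≤ 3 * p.1 ^ 2) with hS
  set T := n.divisorsAntidiagonal.filter (fun p => p.2 ≤ p.1 ∧ p.1 ^ 2 ≤ 3 * p.2 ^ 2) with hT
  have hTS : T.card = S.card := by
    refine Finset.card_nbij' Prod.swap Prod.swap ?_ ?_ (by simp [Set.LeftInvOn])
      (by simp [Set.RightInvOn, Set.LeftInvOn]) <;>
    · intro p hp
      simp only [hS, hT, Finset.coe_filter, Set.mem_ofPred_eq, Nat.mem_divisorsAntidiagonal,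
        Prod.fst_swap, Prod.snd_swap] at hp ⊢
      exact ⟨⟨by rw [mul_comm, hp.1.1], hn⟩, hp.2⟩
  have hunion : S ∪ T = balancedFactorizations n := by
    ext ⟨k, l⟩
    simp only [hS, hT, balancedFactorizations, Finset.mem_union, Finset.mem_filter]
    constructor
    · rintro (⟨h, h1, h2⟩ | ⟨h, h1, h2⟩)
      · exact ⟨h, by nlinarith, h2⟩
      · exact ⟨h, h2, by nlinarith⟩
    · rintro ⟨h, h1, h2⟩
      rcases le_total k l with hkl | hkl
      · exact Or.inl ⟨h, hkl, h2⟩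
      · exact Or.inr ⟨h, hkl, h1⟩
  have hinter : (S ∩ T).card = if IsSquare n then 1 else 0 := by
    split_ifs with hsq
    · obtain ⟨m, rfl⟩ := hsq
      rw [Finset.card_eq_one]
      refine ⟨(m, m), ?_⟩
      ext ⟨k, l⟩
      simp only [hS, hT, Finset.mem_inter, Finset.mem_filter, Nat.mem_divisorsAntidiagonal,
        Finset.mem_singleton, Prod.mk.injEq]
      constructor
      · rintro ⟨⟨⟨h, -⟩, h1, -⟩, -, h2, -⟩
        obtain rfl := le_antisymm h1 h2
        have := Nat.mul_self_inj.1 h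
        exact ⟨this, this⟩
      · rintro ⟨rfl, rfl⟩
        exact ⟨⟨⟨rfl, hn⟩, le_rfl, by omega⟩, ⟨rfl, hn⟩, le_rfl, by omega⟩
    · rw [Finset.card_eq_zero, Finset.eq_empty_iff_forall_notMem]
      rintro ⟨k, l⟩ h
      simp only [hS, hT, Finset.mem_inter, Finset.mem_filter, Nat.mem_divisorsAntidiagonal] at h
      obtain ⟨⟨⟨h, -⟩, h1, -⟩, -, h2, -⟩ := h
      obtain rfl := le_antisymm h1 h2
      exact hsq ⟨k, h.symm⟩
  have hcard := Finset.card_union_add_card_inter S T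
  rw [hunion, hinter, hTS, hS, ← beta_eq_card hn] at hcard
  have hcard' : ((balancedFactorizations n).card : ℚ) + ((if IsSquare n then 1 else 0 : ℕ) : ℚ) =
      beta n + beta n := by exact_mod_cast hcard
  rw [gammaTerm]
  split_ifs at hcard' ⊢ <;> push_cast at hcard' <;> linarith

/-- For N > 2 the coordinates are distinct and nonzero, so each unordered pair gives two vectors.
For N = 1 and N = 2 only (1, 0) and (1, 1) occur, whence the convention 1/2. -/
theorem card_primitiveVectors (N : ℕ) (hN : 0 < N) :
    ((primitiveVectors N).card : ℚ) = 2 * alphaStar N := by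
  by_cases h1 : N = 1
  · subst h1
    have : (primitiveVectors 1).card = 1 := by decide
    simp [this, alphaStar]
  by_cases h2 : N = 2
  · subst h2
    have : (primitiveVectors 2).card = 1 := by decide
    simp [this, alphaStar]
  set R := (Finset.range (N + 1) ×ˢ Finset.range (N + 1)).filter
    (fun p : ℕ × ℕ => p.1 ^ 2 + p.2 ^ 2 = N ∧ p.1 ≤ p.2 ∧ Nat.gcd p.1 p.2 = 1) with hR
  have hmem : ∀ p, p ∈ R ↔ p.1 ^ 2 + p.2 ^ 2 = N ∧ p.1 ≤ p.2 ∧ Nat.gcd p.1 p.2 = 1 := by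
    intro p
    rw [hR, Finset.mem_filter, Finset.mem_product, Finset.mem_range, Finset.mem_range,
      and_iff_right_iff_imp]
    rintro ⟨h, -, -⟩
    constructor <;> nlinarith [Nat.le_self_pow two_ne_zero p.1, Nat.le_self_pow two_ne_zero p.2]
  have hne : ∀ a b : ℕ, a ^ 2 + b ^ 2 = N → Nat.gcd a b = 1 → a ≠ b ∧ a ≠ 0 ∧ b ≠ 0 := by
    intro a b h hg
    refine ⟨?_, ?_, ?_⟩ <;> rintro rfl
    · rw [Nat.gcd_self] at hg
      subst hg
      omega
    · rw [Nat.gcd_zero_left] at hg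
      subst hg
      omega
    · rw [Nat.gcd_zero_right] at hg
      subst hg
      omega
  have hlt : ((primitiveVectors N).filter fun p => p.1 ≤ p.2) = R := by
    ext p
    rw [Finset.mem_filter, mem_primitiveVectors, hmem]
    constructor
    · rintro ⟨⟨h, -, hg⟩, hle⟩
      exact ⟨h, hle, hg⟩
    · rintro ⟨h, hle, hg⟩
      exact ⟨⟨h, Nat.pos_of_ne_zero (hne _ _ h hg).2.1, hg⟩, hle⟩
  have hgt : ((primitiveVectors N).filter fun p => ¬ p.1 ≤ p.2).card = R.card := by
    refine Finset.card_nbij' Prod.swap Prod.swap ?_ ?_ (by simp [Set.LeftInvOn])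
      (by simp [Set.RightInvOn, Set.LeftInvOn])
    · intro p hp
      rw [Finset.mem_coe, Finset.mem_filter, mem_primitiveVectors] at hp
      rw [Finset.mem_coe, hmem]
      exact ⟨by rw [← hp.1.1]; exact add_comm _ _, (not_le.1 hp.2).le,
        by rw [← hp.1.2.2]; exact Nat.gcd_comm _ _⟩
    · intro p hp
      rw [Finset.mem_coe, hmem] at hp
      rw [Finset.mem_coe, Finset.mem_filter, mem_primitiveVectors]
      have := hne _ _ hp.1 hp.2.2
      refine ⟨⟨by rw [← hp.1]; exact add_comm _ _, Nat.pos_of_ne_zero this.2.2,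
        by rw [← hp.2.2]; exact Nat.gcd_comm _ _⟩, ?_⟩
      exact not_le.2 (lt_of_le_of_ne hp.2.1 this.1)
  have hcard := Finset.card_filter_add_card_filter_not (s := primitiveVectors N)
    (fun p => p.1 ≤ p.2)
  rw [hlt, hgt] at hcard
  rw [alphaStar, if_neg (by omega), ← hcard]
  push_cast
  ring

/-- The cofactor t/n is 1, 2 or at least 3. -/
theorem sum_divisors_split {t : ℕ} (ht : 1 < t) (f : ℕ → ℚ) :
    ∑ n ∈ t.divisors, f n = f t + (if Even t then f (t / 2) else 0) +
      ∑ n ∈ t.divisors.filter (fun n => 2 * n < t), f n := by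
  have h1 : t.divisors = insert t
      ((if Even t then {t / 2} else ∅) ∪ t.divisors.filter (fun n => 2 * n < t)) := by
    ext n
    have hhalf : n ∣ t → n = t ∨ 2 * n = t ∨ 2 * n < t := by
      rintro ⟨m, rfl⟩
      rcases m with _ | _ | _ | m
      · omega
      · simp
      · right; left; ring
      · right; right
        have : 0 < n := Nat.pos_of_ne_zero (by rintro rfl; simp at ht)
        nlinarith
    simp only [Finset.mem_insert, Finset.mem_union, Finset.mem_filter, Nat.mem_divisors]
    constructor
    · rintro ⟨hn, ht0⟩
      rcases hhalf hn with h | h | h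
      · exact Or.inl h
      · refine Or.inr (Or.inl ?_)
        rw [if_pos ⟨n, by omega⟩, Finset.mem_singleton]
        omega
      · exact Or.inr (Or.inr ⟨⟨hn, ht0⟩, h⟩)
    · rintro (rfl | h | h)
      · exact ⟨dvd_rfl, by omega⟩
      · split_ifs at h with he
        · rw [Finset.mem_singleton] at h
          subst h
          exact ⟨Nat.div_dvd_of_dvd he.two_dvd, by omega⟩
        · simp at h
      · exact h.1
  conv_lhs => rw [h1]
  rw [Finset.sum_insert, Finset.sum_union]
  · split_ifs <;> simp [add_assoc]
  · split_ifs with he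
    · rw [Finset.disjoint_singleton_left, Finset.mem_filter]
      rintro ⟨-, h⟩
      have := Nat.two_mul_div_two_of_even he
      omega
    · simp
  · rw [Finset.mem_union, Finset.mem_filter]
    rintro (h | ⟨-, h⟩)
    · split_ifs at h
      · rw [Finset.mem_singleton] at h; omega
      · simp at h
    · omega

theorem card_orthParams_eq_countFormula {t : ℕ} (ht : 1 < t) :
    ((orthParams t).card : ℚ) = countFormula t := by
  have h1 : ((orthParams t).card : ℚ) =
      ∑ n ∈ t.divisors, 2 * alphaStar (t / n) * gammaTerm n := by
    rw [card_orthParams]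
    push_cast
    refine Finset.sum_congr rfl fun n hn => ?_
    have hn0 := Nat.pos_of_mem_divisors hn
    rw [card_balancedFactorizations hn0.ne',
      card_primitiveVectors _ (Nat.div_pos (Nat.divisor_le hn) hn0)]
  have hA1 : alphaStar 1 = 1 / 2 := by simp [alphaStar]
  have hA2 : alphaStar 2 = 1 / 2 := by simp [alphaStar]
  rw [h1, sum_divisors_split ht, countFormula, Nat.div_self (by omega), hA1, add_assoc, add_assoc,
    add_assoc]
  congr 1
  · ring
  congr 1
  · split_ifs with he
    · obtain ⟨m, rfl⟩ := he
      rw [show (m + m) / ((m + m) / 2) = 2 by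
        rw [show (m + m) / 2 = m by omega, ← two_mul, Nat.mul_div_cancel _ (by omega)], hA2]
      ring
    · rfl
  · rw [← Finset.sum_filter_add_sum_filter_not _ (fun n => IsSquare n), add_comm,
      Finset.filter_filter, Finset.filter_filter, Finset.mul_sum, Finset.mul_sum]
    congr 1
    · refine Finset.sum_congr ?_ ?_
      · refine Finset.filter_congr fun n hn => ?_
        have hn0 := Nat.pos_of_mem_divisors hn
        constructor
        · rintro ⟨h, hsq⟩
          -- The condition 1 < n is automatic, since 1 is a square.
          refine ⟨lt_of_le_of_ne hn0 ?_, h, hsq⟩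
          rintro rfl
          exact hsq IsSquare.one
        · rintro ⟨-, h⟩
          exact h
      · intro n hn
        rw [gammaTerm, if_neg (Finset.mem_filter.1 hn).2.2.2]
        ring
    · refine Finset.sum_congr ?_ ?_
      · refine Finset.filter_congr fun n hn => ?_
        have hn0 := Nat.pos_of_mem_divisors hn
        exact ⟨fun h => ⟨hn0, h⟩, fun h => h.2⟩
      · intro n hn
        rw [gammaTerm, if_pos (Finset.mem_filter.1 hn).2.2.2]
        ring

theorem mainTheorem11 (A : Matrix (Fin 2) (Fin 2) ℝ)
    (hA : A ∈ Matrix.orthogonalGroup (Fin 2) ℝ) :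
    detSet (imageLattice A) = detSet intLattice ∧
    minimaSet (imageLattice A) = minimaSet intLattice ∧
    (∀ u ∈ detSet intLattice, ∃ m : ℕ, 0 < m ∧ u = (m : ℝ)) ∧
    ∀ u : ℕ, 0 < u →
      (WRdet (imageLattice A) (u : ℝ)).Finite ∧
      (WRdet (imageLattice A) (u : ℝ)).ncard = numWR u ∧
      (u ≤ 2 → numWR u = 1) ∧
      (2 < u → (numWR u : ℚ) = countFormula (tOf u)) := by
  obtain ⟨f, hf⟩ := exists_imageLattice_eq_isometryMap hA
  rw [hf]
  refine ⟨detSet_isometryMap f _, minimaSet_isometryMap f _,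
    fun u hu => exists_nat_of_mem_detSet hu, fun u hu => ⟨?_, ?_, fun h => ?_, fun h => ?_⟩⟩
  · rw [WRdet_isometryMap]
    exact (finite_WRdet_intLattice hu).image _
  · rw [WRdet_isometryMap, Set.ncard_image_of_injective _ (isometryMap_injective f), numWR]
  · have ht : tOf u = 1 := by
      obtain rfl | rfl : u = 1 ∨ u = 2 := by omega
      · simp [tOf]
      · simp [tOf]
    rw [numWR_eq_card hu, ht, card_orthParams_one]
  · rw [numWR_eq_card hu]
    apply card_orthParams_eq_countFormula
    unfold tOf
    split_ifs with he
    · obtain ⟨v, rfl⟩ := he; omega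
    · exact lt_trans one_lt_two h
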